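/- **Setting.** Let $(\Omega,\bar{\mathscr F},\mathbb P)$ be a probability space with a filtration $(\bar{\mathscr F}_t)_{0\le t\le T}$ satisfying the usual conditions of completeness and right-continuity. It carries two $m$-dimensional Brownian motions $W,B$ and a stationary Poisson point process on a non-empty Borel set $\mathcal Z\subset\mathbb R^l$ with finite characteristic measure $\mu$ and Poisson random measure $\pi(dz,dt)$. The three are mutually independent and, on $[0,T]$, adapted to $(\bar{\mathscr F}_t)$ with increments independent of the past of $(\bar{\mathscr F}_t)$. Let $\mathscr P$ be the predictable $\sigma$-algebra of the filtration generated by $W$ and the $\mathbb P$-null sets. The coefficients $b$ ($\mathbb R^d$-valued), $\sigma,\bar\sigma$ ($\mathbb R^{d\times m}$-valued) and $\eta,\lambda\ge 0$ are $\mathscr P\times\mathscr B(\mathbb R^d)$-measurable and essentially bounded; $\gamma$, with values in $[0,\infty]$, is $\mathscr P\times\mathscr B(\mathbb R^d)\times\mathscr B(\mathcal Z)$-measurable; $b,\sigma,\bar\sigma$ are Lipschitz in $y$ uniformly in $(\omega,t)$; and there are $\kappa,\kappa_0>0$ with $\bar\sigma_t\bar\sigma_t^{\mathcal T}(y)\ge\kappa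 I$ and $\eta_t(y)\ge\kappa_0$ almost surely, for all $(t,y)$. For $y\in\mathbb R^d$ let $y_t$ be the solution of $dy_t=b_t(y_t)\,dt+\bar\sigma_t(y_t)\,dB_t+\sigma_t(y_t)\,dW_t$, $y_0=y$. For $x\in\mathbb R$, a pair $(\xi,\rho)$ of $\bar{\mathscr F}$-predictable processes with $E\int_0^T|\xi_s|^2ds<\infty$ and $E\int_0^T\int_{\mathcal Z}|\rho_s(z)|^2\mu(dz)\,ds<\infty$ is an *admissible control* for $x$ if the state process $$x_t^{0,x;\xi,\rho}=x-\int_0^t\xi_s\,ds-\int_0^t\int_{\mathcal Z}\rho_s(z)\,\pi(dz,ds),\qquad t\in[0,T],$$ satisfies $x_T^{0,x;\xi,\rho}=0$ almost surely. Its cost for the initial state $(x,y)$ is $$J_0(x,y;\xi,\rho)=E\Big[\int_0^T\Big\{\eta_s(y_s)|\xi_s|^2+\lambda_s(y_s)|x_s^{0,x;\xi,\rho}|^2+\int_{\mathcal Z}\gamma_s(y_s,z)|\rho_s(z)|^2\mu(dz)\Big\}ds\,\Big|\,\bar{\mathscr F}_0\Big]\in[0,\infty].$$ **Lemma.** There is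 a constant $C<\infty$ (depending on the setting, but not on $t$, $x$ or the controls) such that for every $x\in\mathbb R$ and every admissible control $(\xi,\rho)$ for $x$ there is an admissible control $(\hat\xi,\hat\rho)$ for $x$ such that 1. for every $y\in\mathbb R^d$, $J_0(x,y;\hat\xi,\hat\rho)\le J_0(x,y;\xi,\rho)$ almost surely; 2. almost surely, the path $t\mapsto x_t^{0,x;\hat\xi,\hat\rho}$ is monotone on $[0,T]$; 3. for every $t\in[0,T]$, almost surely, $$|x_t^{0,x;\hat\xi,\hat\rho}|^2\le C\,(T-t)\,E\Big[\int_t^T|\hat\xi_s|^2\,ds\,\Big|\,\bar{\mathscr F}_t\Big].$$ -/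

import Mathlib

open MeasureTheory ProbabilityTheory Set Filter
open scoped NNReal ENNReal Topology

noncomputable section

namespace Liquidation

/-! ### Driving noise -/

/-- Lebesgue measure on the time axis `[0, ∞)`. -/
def dt : Measure ℝ≥0 := Measure.comap (fun t : ℝ≥0 => (t : ℝ)) (volume : Measure ℝ)

/-- The counting measure `π(dt, dz)` of a point function `p`, where `p t = some z` means that a
point with mark `z` occurs at time `t`, and `p t = none` that no point occurs at time `t`. -/
def jumpMeasure {S : Type*} [MeasurableSpace S] (p : ℝ≥0 → Option S) : Measure (ℝ≥0 × S) :=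
  Measure.sum fun a : {a : ℝ≥0 × S // p a.1 = some a.2} => Measure.dirac (a : ℝ≥0 × S)

/-- `J` is a stationary Poisson point process with characteristic measure `μ`: it is a random
point function whose counting measure is a Poisson random measure with intensity `dt ⊗ μ(dz)`. -/
structure IsPoissonPointProcess {Ω S : Type*} [MeasurableSpace Ω] [MeasurableSpace S]
    (J : ℝ≥0 → Ω → Option S) (μ : Measure S) (P : Measure Ω) : Prop where
  zero : ∀ ω, J 0 ω = none
  countable : ∀ ω, {t | J t ω ≠ none}.Countable
  measurable : Measurable fun ω => jumpMeasure fun t => J t ω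
  law : ∀ A : Set (ℝ≥0 × S), MeasurableSet A → (dt.prod μ) A ≠ ∞ →
    HasLaw (fun ω => jumpMeasure (fun t => J t ω) A)
      ((poissonMeasure ((dt.prod μ) A).toNNReal).map
        (Nat.cast : ℕ → ℝ≥0∞)) P
  indep : ∀ (n : ℕ) (A : Fin n → Set (ℝ≥0 × S)), (∀ i, MeasurableSet (A i)) →
    (∀ i j, i ≠ j → Disjoint (A i) (A j)) →
    iIndepFun (fun i ω => jumpMeasure (fun t => J t ω) (A i)) P

/-- `W` is a standard `m`-dimensional Brownian motion. -/
structure IsBrownianVec {Ω : Type*} [MeasurableSpace Ω] {m : ℕ}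
    (W : ℝ≥0 → Ω → Fin m → ℝ) (P : Measure Ω) : Prop where
  measurable : ∀ t, Measurable (W t)
  brownian : ∀ i, IsBrownianReal (fun t ω => W t ω i) P
  indep : iIndepFun (fun (i : Fin m) (ω : Ω) (t : ℝ≥0) => W t ω i) P

/-- `W` is adapted to `𝓖` on `[0, T]`, with increments independent of the past of `𝓖`. -/
structure IsCompatibleBrownian {Ω : Type*} [mΩ : MeasurableSpace Ω] {m : ℕ}
    (W : ℝ≥0 → Ω → Fin m → ℝ) (𝓖 : Filtration ℝ≥0 mΩ) (T : ℝ≥0) (P : Measure Ω) : Prop where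
  adapted : ∀ t ≤ T, Measurable[𝓖 t] (W t)
  indep : ∀ s t, s ≤ t → t ≤ T →
    Indep (MeasurableSpace.comap (fun ω => W t ω - W s ω) inferInstance) (𝓖 s) P

/-- The point process `J` is adapted to `𝓖` on `[0, T]`, and after each time `s` it is independent
of the past of `𝓖`. -/
structure IsCompatiblePoint {Ω S : Type*} [mΩ : MeasurableSpace Ω] [MeasurableSpace S]
    (J : ℝ≥0 → Ω → Option S) (𝓖 : Filtration ℝ≥0 mΩ) (T : ℝ≥0) (P : Measure Ω) : Prop where
  adapted : ∀ t ≤ T,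
    Measurable[𝓖 t] fun ω => (jumpMeasure fun r => J r ω).restrict (Ioc 0 t ×ˢ univ)
  indep : ∀ s ≤ T,
    Indep (MeasurableSpace.comap
      (fun ω => (jumpMeasure fun r => J r ω).restrict (Ioc s T ×ˢ univ)) inferInstance) (𝓖 s) P

/-- The standing assumptions on the stochastic basis. The filtration `𝓖` matters on `[0, T]` only
(a filtration on `[0, T]` is regarded as constant after `T`); it satisfies the usual conditions,
and `W`, `B` and `J` are mutually independent and compatible with it. -/
structure IsNoise {Ω S : Type*} [mΩ : MeasurableSpace Ω] [MeasurableSpace S] {m : ℕ}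
    (P : Measure Ω) (𝓖 : Filtration ℝ≥0 mΩ) (T : ℝ≥0) (W B : ℝ≥0 → Ω → Fin m → ℝ)
    (J : ℝ≥0 → Ω → Option S) (μ : Measure S) : Prop where
  complete : ∀ N : Set Ω, P N = 0 → MeasurableSet[𝓖 0] N
  rightContinuous : 𝓖.IsRightContinuous
  brownian_W : IsBrownianVec W P
  brownian_B : IsBrownianVec B P
  poisson : IsPoissonPointProcess J μ P
  compatible_W : IsCompatibleBrownian W 𝓖 T P
  compatible_B : IsCompatibleBrownian B 𝓖 T P
  compatible_J : IsCompatiblePoint J 𝓖 T P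
  indep : iIndep ![⨆ t, MeasurableSpace.comap (W t) inferInstance,
    ⨆ t, MeasurableSpace.comap (B t) inferInstance,
    MeasurableSpace.comap (fun ω => jumpMeasure fun t => J t ω) inferInstance] P

/-- The filtration generated by `W` together with all `P`-null sets. -/
def brownianFiltration {Ω : Type*} [mΩ : MeasurableSpace Ω] {m : ℕ} (P : Measure Ω)
    (W : ℝ≥0 → Ω → Fin m → ℝ) (hW : ∀ t, Measurable (W t))
    (hP : ∀ N : Set Ω, P N = 0 → MeasurableSet N) : Filtration ℝ≥0 mΩ where
  seq t := (⨆ s ∈ Iic t, MeasurableSpace.comap (W s) inferInstance) ⊔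
    MeasurableSpace.generateFrom {N | P N = 0}
  mono' _ _ hst := sup_le_sup_right (biSup_mono fun _ hr => le_trans hr hst) _
  le' _ := sup_le (iSup₂_le fun s _ => (hW s).comap_le)
    (MeasurableSpace.generateFrom_le hP)

/-- The filtration generated by `W` and the null sets, under the standing assumptions. -/
def IsNoise.filtrationW {Ω S : Type*} [mΩ : MeasurableSpace Ω] [MeasurableSpace S] {m : ℕ}
    {P : Measure Ω} {𝓖 : Filtration ℝ≥0 mΩ} {T : ℝ≥0} {W B : ℝ≥0 → Ω → Fin m → ℝ}
    {J : ℝ≥0 → Ω → Option S} {μ : Measure S} (h : IsNoise P 𝓖 T W B J μ) :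
    Filtration ℝ≥0 mΩ :=
  brownianFiltration P W h.brownian_W.measurable fun N hN => 𝓖.le 0 N (h.complete N hN)

/-! ### Itô integral -/

/-- A simple process `∑ₖ cₖ 1_(τₖ, τₖ₊₁]` with bounded `𝓖_{τₖ}`-measurable `cₖ`. -/
structure SimpleProcess {Ω : Type*} [mΩ : MeasurableSpace Ω] (𝓖 : Filtration ℝ≥0 mΩ) where
  n : ℕ
  τ : ℕ → ℝ≥0
  c : ℕ → Ω → ℝ
  mono : Monotone τ
  measurable : ∀ k, Measurable[𝓖 (τ k)] (c k)
  bounded : ∃ K : ℝ, ∀ k ω, |c k ω| ≤ K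

/-- The value of a simple process at time `t`. -/
def SimpleProcess.eval {Ω : Type*} [mΩ : MeasurableSpace Ω] {𝓖 : Filtration ℝ≥0 mΩ}
    (H : SimpleProcess 𝓖) (t : ℝ≥0) (ω : Ω) : ℝ :=
  ∑ k ∈ Finset.range H.n, (Ioc (H.τ k) (H.τ (k + 1))).indicator (fun _ => H.c k ω) t

/-- The elementary stochastic integral `∫₀ᵗ H dX` of a simple process. -/
def SimpleProcess.integral {Ω : Type*} [mΩ : MeasurableSpace Ω] {𝓖 : Filtration ℝ≥0 mΩ}
    (H : SimpleProcess 𝓖) (X : ℝ≥0 → Ω → ℝ) (t : ℝ≥0) (ω : Ω) : ℝ :=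
  ∑ k ∈ Finset.range H.n, H.c k ω * (X (min (H.τ (k + 1)) t) ω - X (min (H.τ k) t) ω)

/-- `M` is (a version with continuous paths of) the Itô integral `∫₀ᵗ H dX`, `t ∈ [0, T]`, with
respect to the Brownian motion `X`: the `L²`-limit of elementary integrals of simple processes
that converge to `H` in `L²(P ⊗ dt)`. -/
def IsItoIntegral {Ω : Type*} [mΩ : MeasurableSpace Ω] (P : Measure Ω) (𝓖 : Filtration ℝ≥0 mΩ)
    (T : ℝ≥0) (X H M : ℝ≥0 → Ω → ℝ) : Prop :=
  (∀ t ≤ T, Measurable[𝓖 t] (M t)) ∧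
  (∀ᵐ ω ∂P, ContinuousOn (fun t => M t ω) (Icc 0 T)) ∧
  ∃ S : ℕ → SimpleProcess 𝓖,
    Tendsto (fun n => ∫⁻ ω, (∫⁻ t in Icc 0 T, ‖(S n).eval t ω - H t ω‖ₑ ^ 2 ∂dt) ∂P) atTop (𝓝 0) ∧
    ∀ t ≤ T, Tendsto (fun n => ∫⁻ ω, ‖(S n).integral X t ω - M t ω‖ₑ ^ 2 ∂P) atTop (𝓝 0)

/-! ### Coefficients and factor process -/

/-- The random coefficients `b, σ, σ̄` of the factor process and `η, λ, γ` of the cost. -/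
structure Coefficients (Ω S : Type*) (d m : ℕ) where
  b : ℝ≥0 → Ω → EuclideanSpace ℝ (Fin d) → EuclideanSpace ℝ (Fin d)
  σ : ℝ≥0 → Ω → EuclideanSpace ℝ (Fin d) → Fin d → Fin m → ℝ
  σbar : ℝ≥0 → Ω → EuclideanSpace ℝ (Fin d) → Fin d → Fin m → ℝ
  η : ℝ≥0 → Ω → EuclideanSpace ℝ (Fin d) → ℝ≥0
  lam : ℝ≥0 → Ω → EuclideanSpace ℝ (Fin d) → ℝ≥0
  γ : ℝ≥0 → Ω → EuclideanSpace ℝ (Fin d) → S → ℝ≥0∞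

/-- The Euclidean (Frobenius) norm of a matrix. -/
def frobNorm {d m : ℕ} (A : Fin d → Fin m → ℝ) : ℝ := √(∑ i, ∑ j, A i j ^ 2)

/-- The product of the `𝓕`-predictable σ-algebra on `[0, ∞) × Ω` with the given σ-algebra. -/
abbrev predictableProd {Ω : Type*} [mΩ : MeasurableSpace Ω] (𝓕 : Filtration ℝ≥0 mΩ)
    (X : Type*) [mX : MeasurableSpace X] : MeasurableSpace ((ℝ≥0 × Ω) × X) :=
  @Prod.instMeasurableSpace (ℝ≥0 × Ω) X 𝓕.predictable mX

/-- The standing assumptions on the coefficients: predictability and essential boundedness,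
Lipschitz continuity in space, and non-degeneracy. -/
structure Coefficients.IsRegular {Ω S : Type*} [mΩ : MeasurableSpace Ω] [MeasurableSpace S]
    {d m : ℕ} (c : Coefficients Ω S d m) (P : Measure Ω) (𝓕 : Filtration ℝ≥0 mΩ)
    (T : ℝ≥0) : Prop where
  measurable_b : Measurable[predictableProd 𝓕 _] fun p => c.b p.1.1 p.1.2 p.2
  measurable_σ : Measurable[predictableProd 𝓕 _] fun p => c.σ p.1.1 p.1.2 p.2
  measurable_σbar : Measurable[predictableProd 𝓕 _] fun p => c.σbar p.1.1 p.1.2 p.2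
  measurable_η : Measurable[predictableProd 𝓕 _] fun p => c.η p.1.1 p.1.2 p.2
  measurable_lam : Measurable[predictableProd 𝓕 _] fun p => c.lam p.1.1 p.1.2 p.2
  measurable_γ : Measurable[predictableProd 𝓕 (EuclideanSpace ℝ (Fin d) × S)]
    fun p => c.γ p.1.1 p.1.2 p.2.1 p.2.2
  bounded : ∃ Λ : ℝ, 0 < Λ ∧
    ∀ᵐ p ∂(((dt.restrict (Icc 0 T)).prod P).prod
        (volume : Measure (EuclideanSpace ℝ (Fin d)))),
      ‖c.b p.1.1 p.1.2 p.2‖ ≤ Λ ∧ frobNorm (c.σ p.1.1 p.1.2 p.2) ≤ Λ ∧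
      frobNorm (c.σbar p.1.1 p.1.2 p.2) ≤ Λ ∧ (c.η p.1.1 p.1.2 p.2 : ℝ) ≤ Λ ∧
      (c.lam p.1.1 p.1.2 p.2 : ℝ) ≤ Λ
  lipschitz : ∃ L : ℝ, ∀ t ≤ T, ∀ ω y₁ y₂,
    ‖c.b t ω y₁ - c.b t ω y₂‖ + frobNorm (c.σ t ω y₁ - c.σ t ω y₂) +
      frobNorm (c.σbar t ω y₁ - c.σbar t ω y₂) ≤ L * ‖y₁ - y₂‖
  elliptic : ∃ κ : ℝ, 0 < κ ∧ ∀ t ≤ T, ∀ y v : EuclideanSpace ℝ (Fin d), ∀ᵐ ω ∂P,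
    κ * ‖v‖ ^ 2 ≤ ∑ i, ∑ j, ∑ r, c.σbar t ω y i r * c.σbar t ω y j r * v i * v j
  η_pos : ∃ κ₀ : ℝ≥0, 0 < κ₀ ∧ ∀ t ≤ T, ∀ y, ∀ᵐ ω ∂P, κ₀ ≤ c.η t ω y

/-- `Y` is the factor process started from `y` at time `0`, that is, a continuous adapted solution
on `[0, T]` of `dY = b(Y) dt + σ̄(Y) dB + σ(Y) dW`. -/
structure IsFactorProcess {Ω S : Type*} [mΩ : MeasurableSpace Ω] {d m : ℕ}
    (c : Coefficients Ω S d m) (P : Measure Ω) (𝓖 : Filtration ℝ≥0 mΩ) (T : ℝ≥0)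
    (W B : ℝ≥0 → Ω → Fin m → ℝ) (y : EuclideanSpace ℝ (Fin d))
    (Y : ℝ≥0 → Ω → EuclideanSpace ℝ (Fin d)) : Prop where
  adapted : ∀ t ≤ T, Measurable[𝓖 t] (Y t)
  continuous : ∀ᵐ ω ∂P, ContinuousOn (fun t => Y t ω) (Icc 0 T)
  equation : ∃ MB MW : Fin d → Fin m → ℝ≥0 → Ω → ℝ,
    (∀ i j, IsItoIntegral P 𝓖 T (fun t ω => B t ω j) (fun t ω => c.σbar t ω (Y t ω) i j)
      (MB i j)) ∧
    (∀ i j, IsItoIntegral P 𝓖 T (fun t ω => W t ω j) (fun t ω => c.σ t ω (Y t ω) i j)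
      (MW i j)) ∧
    ∀ᵐ ω ∂P, ∀ t ≤ T, ∀ i, Y t ω i = y i + (∫ s in Ioc 0 t, c.b s ω (Y s ω) i ∂dt) +
      ∑ j, MB i j t ω + ∑ j, MW i j t ω

/-! ### Controls, state process and cost -/

/-- The state process `x_t = x - ∫₀ᵗ ξ_s ds - ∫₀ᵗ ∫ ρ_s(z) π(dz, ds)` started from `x` at time
`0`. -/
def state {Ω S : Type*} [MeasurableSpace S] (J : ℝ≥0 → Ω → Option S) (x : ℝ)
    (ξ : ℝ≥0 → Ω → ℝ) (ρ : ℝ≥0 → Ω → S → ℝ) (t : ℝ≥0) (ω : Ω) : ℝ :=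
  x - (∫ s in Ioc 0 t, ξ s ω ∂dt) -
    ∫ p in Ioc 0 t ×ˢ univ, ρ p.1 ω p.2 ∂(jumpMeasure fun r => J r ω)

/-- Admissibility of the control `(ξ, ρ)` for the initial state `x` at time `0`: both components
are `𝓖`-predictable and square integrable, and the state process vanishes at time `T`. -/
structure IsAdmissible {Ω S : Type*} [mΩ : MeasurableSpace Ω] [MeasurableSpace S]
    (P : Measure Ω) (𝓖 : Filtration ℝ≥0 mΩ) (T : ℝ≥0) (J : ℝ≥0 → Ω → Option S)
    (μ : Measure S) (x : ℝ) (ξ : ℝ≥0 → Ω → ℝ) (ρ : ℝ≥0 → Ω → S → ℝ) : Prop where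
  measurable_ξ : Measurable[𝓖.predictable] fun p : ℝ≥0 × Ω => ξ p.1 p.2
  measurable_ρ : Measurable[predictableProd 𝓖 S] fun p => ρ p.1.1 p.1.2 p.2
  integrable_ξ : ∫⁻ ω, (∫⁻ s in Icc 0 T, ‖ξ s ω‖ₑ ^ 2 ∂dt) ∂P < ∞
  integrable_ρ : ∫⁻ ω, (∫⁻ s in Icc 0 T, (∫⁻ z, ‖ρ s ω z‖ₑ ^ 2 ∂μ) ∂dt) ∂P < ∞
  terminal : ∀ᵐ ω ∂P, state J x ξ ρ T ω = 0

/-- The pathwise cost over `[0, T]`, given the factor process `Y`. -/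
def pathCost {Ω S : Type*} [MeasurableSpace S] {d m : ℕ} (c : Coefficients Ω S d m) (T : ℝ≥0)
    (J : ℝ≥0 → Ω → Option S) (μ : Measure S) (Y : ℝ≥0 → Ω → EuclideanSpace ℝ (Fin d)) (x : ℝ)
    (ξ : ℝ≥0 → Ω → ℝ) (ρ : ℝ≥0 → Ω → S → ℝ) (ω : Ω) : ℝ≥0∞ :=
  ∫⁻ s in Icc 0 T, ((c.η s ω (Y s ω) : ℝ≥0∞) * ‖ξ s ω‖ₑ ^ 2 +
    (c.lam s ω (Y s ω) : ℝ≥0∞) * ‖state J x ξ ρ s ω‖ₑ ^ 2 +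
    ∫⁻ z, c.γ s ω (Y s ω) z * ‖ρ s ω z‖ₑ ^ 2 ∂μ) ∂dt

/-- The cost `J₀(x, y; ξ, ρ)`: the conditional expectation of the pathwise cost given `𝓖₀`, with
`Y` the factor process started from `y`. -/
def cost {Ω S : Type*} [mΩ : MeasurableSpace Ω] [MeasurableSpace S] {d m : ℕ}
    (c : Coefficients Ω S d m) (P : Measure Ω) (𝓖 : Filtration ℝ≥0 mΩ) (T : ℝ≥0)
    (J : ℝ≥0 → Ω → Option S) (μ : Measure S) (Y : ℝ≥0 → Ω → EuclideanSpace ℝ (Fin d)) (x : ℝ)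
    (ξ : ℝ≥0 → Ω → ℝ) (ρ : ℝ≥0 → Ω → S → ℝ) : Ω → ℝ≥0∞ :=
  condLExp (𝓖 0) P (pathCost c T J μ Y x ξ ρ)

end Liquidation

end

/-! By the symmetry `(x, ξ, ρ) ↦ (-x, -ξ, -ρ)` it suffices to treat `x ≥ 0`. Given the state path
`X`, consider the running minimum `M_t = inf_{s ≤ t} X_s⁺`. It is nonnegative and nonincreasing,
starts at `x`, satisfies `M ≤ X⁺ ≤ |X|`, and ends at `0` because `X_T = 0`. The point is that `M` is
itself the state of a predictable control that is pointwise no larger than the original one. Between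
jumps `M` moves only when `X_- = M_- > 0`, and then at rate `ξ⁺`; at a jump with mark `z` it drops
from `M_-` to `min (M_-) ((X_- - ρ(z))⁺)`. Thus rate, jumps and state all shrink in absolute value,
and the cost decreases pathwise, whatever the weights `η, λ, γ ≥ 0` are. The carrying lemmas are
`runningMin_eq_sub_integral` (dynamics between jumps), `runningMin_eq_jumpPath` (gluing across
jumps) and `IsLocalizedControl.state_minControl`.

Predictability holds because the new control is a function of `ξ`, `ρ`, `X_-` and `M_-`. To have the
regularity of paths for every `ω`, the control is first set to zero outside `(0, T]` and off an
event of probability one, which is known at time `0` by completeness of the filtration.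

For the last estimate, let `D` be the event of no jump in `(t, T]`. On `D` the terminal condition
forces `X_t = ∫_t^T ξ`, so Cauchy–Schwarz gives `X_t² 1_D ≤ (T - t) ∫_t^T ξ²`. Since `D` is
independent of `𝓖 t` with probability `exp (-(T - t) μ(Z))`, conditioning on `𝓖 t` bounds `X_t²`
with `C = exp (T μ(Z))`. Integrability of `X_t²` comes from the bound `|M| ≤ |x|`, so the estimate
is applied to the new control. -/

noncomputable section

namespace Liquidation

/-! ### Calculus of the running minimum between jumps -/

/-- A function whose oscillation is dominated by the integral of an integrable function is
absolutely continuous. -/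
theorem absolutelyContinuousOnInterval_of_dist_le {f M : ℝ → ℝ} {a b : ℝ} (hab : a ≤ b)
    (hf : IntervalIntegrable f volume a b)
    (h : ∀ s ∈ Icc a b, ∀ u ∈ Icc a b, s ≤ u → |M s - M u| ≤ ∫ v in s..u, |f v|) :
    AbsolutelyContinuousOnInterval M a b := by
  have hI := hf.abs.absolutelyContinuousOnInterval_intervalIntegral (c := a) (by simp)
  have key : ∀ s ∈ Icc a b, ∀ u ∈ Icc a b,
      dist (M s) (M u) ≤ dist (∫ v in a..s, |f v|) (∫ v in a..u, |f v|) := by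
    have aux : ∀ s ∈ Icc a b, ∀ u ∈ Icc a b, s ≤ u →
        dist (M s) (M u) ≤ dist (∫ v in a..s, |f v|) (∫ v in a..u, |f v|) := by
      intro s hs u hu hsu
      rw [Real.dist_eq, dist_comm, Real.dist_eq, intervalIntegral.integral_interval_sub_left]
      · exact (h s hs u hu hsu).trans (le_abs_self _)
      · exact hf.abs.mono_set (by rw [uIcc_of_le hab, uIcc_of_le hu.1]; exact Icc_subset_Icc_right hu.2)
      · exact hf.abs.mono_set (by rw [uIcc_of_le hab, uIcc_of_le hs.1]; exact Icc_subset_Icc_right hs.2)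
    intro s hs u hu
    rcases le_total s u with hsu | hsu
    · exact aux s hs u hu hsu
    · rw [dist_comm, dist_comm (∫ v in a..s, |f v|)]
      exact aux u hu s hs hsu
  refine squeeze_zero' (Eventually.of_forall fun E => Finset.sum_nonneg fun _ _ => dist_nonneg) ?_ hI
  -- Only the constraint that the intervals of a family have endpoints in `[a, b]` is needed here;
  -- smallness of the total length enters through `hI`.
  refine Filter.Eventually.filter_mono inf_le_right ?_
  rw [eventually_principal]
  intro E hE
  refine Finset.sum_le_sum fun i hi => ?_
  have := hE.1 i hi
  rw [uIcc_of_le hab] at this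
  exact key _ this.1 _ this.2

/-- Between jumps, the running minimum `M` of the positive part of an absolutely continuous path
`G` with derivative `-f` decreases at rate `f` when `G = M > 0` and is constant otherwise. -/
theorem runningMin_eq_sub_integral {f G M : ℝ → ℝ} {a b : ℝ} (hab : a ≤ b)
    (hf : IntervalIntegrable f volume a b)
    (hG : ∀ u ∈ Icc a b, G u = G a - ∫ s in a..u, f s) (h0 : ∀ u ∈ Icc a b, 0 ≤ M u)
    (hanti : AntitoneOn M (Icc a b)) (hle : ∀ u ∈ Icc a b, M u ≤ max 0 (G u))
    (hglb : ∀ s ∈ Icc a b, ∀ u ∈ Icc a b, s ≤ u → ∀ c, c ≤ M s →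
      (∀ v ∈ Icc s u, c ≤ max 0 (G v)) → c ≤ M u) :
    M b = M a - ∫ s in a..b, if G s = M s ∧ 0 < M s then max 0 (f s) else 0 := by
  have hsub : ∀ s ∈ Icc a b, ∀ u ∈ Icc a b, s ≤ u → IntervalIntegrable f volume s u := by
    intro s hs u hu hsu
    refine hf.mono_set ?_
    rw [uIcc_of_le hab, uIcc_of_le hsu]
    exact Icc_subset_Icc hs.1 hu.2
  have hGsub : ∀ s ∈ Icc a b, ∀ u ∈ Icc a b, s ≤ u → G u = G s - ∫ v in s..u, f v := by
    intro s hs u hu hsu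
    rw [hG u hu, hG s hs, ← intervalIntegral.integral_add_adjacent_intervals
      (hsub a (left_mem_Icc.2 hab) s hs hs.1) (hsub s hs u hu hsu)]
    ring
  have hosc : ∀ s ∈ Icc a b, ∀ u ∈ Icc a b, s ≤ u → |M s - M u| ≤ ∫ v in s..u, |f v| := by
    intro s hs u hu hsu
    rw [abs_of_nonneg (sub_nonneg.2 (hanti hs hu hsu)), sub_le_comm]
    have hpos : 0 ≤ ∫ v in s..u, |f v| :=
      intervalIntegral.integral_nonneg hsu fun _ _ => abs_nonneg _
    -- On `[s, u]` the path `G` cannot fall below `G s - ∫ |f|`, so `M s - ∫ |f|` bounds both `M s`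
    -- and `G⁺` on `[s, u]` from below.
    refine hglb s hs u hu hsu _ (by linarith) fun v hv => ?_
    have hvab : v ∈ Icc a b := ⟨hs.1.trans hv.1, hv.2.trans hu.2⟩
    have h1 : ∫ w in s..v, f w ≤ ∫ w in s..u, |f w| := by
      have e1 : ∫ w in s..v, f w ≤ ∫ w in s..v, |f w| :=
        intervalIntegral.integral_mono_on hv.1 (hsub s hs v hvab hv.1)
          (hsub s hs v hvab hv.1).abs fun _ _ => le_abs_self _
      have e2 : ∫ w in s..u, |f w| = (∫ w in s..v, |f w|) + ∫ w in v..u, |f w| :=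
        (intervalIntegral.integral_add_adjacent_intervals (hsub s hs v hvab hv.1).abs
          (hsub v hvab u hu hv.2).abs).symm
      have e3 : 0 ≤ ∫ v in v..u, |f v| :=
        intervalIntegral.integral_nonneg hv.2 fun _ _ => abs_nonneg _
      linarith
    have h2 := hGsub s hs v hvab hv.1
    rcases le_max_iff.1 (hle s hs) with h3 | h3
    · exact le_max_of_le_left (by linarith)
    · exact le_max_of_le_right (by linarith)
  have hac := absolutelyContinuousOnInterval_of_dist_le hab hf hosc
  have hderiv : ∀ᵐ x, x ∈ uIoc a b →
      deriv M x = -(if G x = M x ∧ 0 < M x then max 0 (f x) else 0) := by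
    filter_upwards [hac.ae_differentiableAt, hf.ae_hasDerivAt_integral,
      (measure_eq_zero_iff_ae_notMem.1 (measure_singleton b) : ∀ᵐ x, x ∉ ({b} : Set ℝ))] with x hx₁ hx₂ hxb hx
    rw [uIoc_of_le hab] at hx
    have hxab : x ∈ Ioo a b := ⟨hx.1, lt_of_le_of_ne hx.2 (by simpa using hxb)⟩
    have hxI : x ∈ Icc a b := Ioo_subset_Icc_self hxab
    have hxu : x ∈ uIcc a b := by rwa [uIcc_of_le hab]
    have hM := (hx₁ hxu).hasDerivAt
    have hnhds : Icc a b ∈ 𝓝 x := Icc_mem_nhds hxab.1 hxab.2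
    have hGd : HasDerivAt G (-f x) x := by
      have := (hx₂ hxu a (by simp)).const_sub (G a)
      refine this.congr_of_eventuallyEq ?_
      filter_upwards [hnhds] with u hu using hG u hu
    split_ifs with hc
    -- Near `x` one has `M ≤ G`, with contact at `x`, so the derivatives agree. As `M` is
    -- nonincreasing, this also forces `f x ≥ 0`, hence `f x = max 0 (f x)`.
    · have hGpos : ∀ᶠ u in 𝓝 x, 0 < G u :=
        hGd.continuousAt.eventually (lt_mem_nhds (by rw [hc.1]; exact hc.2))
      have hmin : IsLocalMin (fun u => G u - M u) x := by
        filter_upwards [hnhds, hGpos] with u hu hGu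
        have := hle u hu
        rw [max_eq_right hGu.le] at this
        rw [hc.1]; linarith
      have h1 := hmin.hasDerivAt_eq_zero (hGd.sub hM)
      have h2 : deriv M x ≤ 0 := by
        have := hanti.derivWithin_nonpos (x := x)
        rwa [derivWithin_of_mem_nhds hnhds] at this
      rw [max_eq_right (by linarith)]
      linarith
    · rw [neg_zero]
      rcases (h0 x hxI).eq_or_lt with hz | hpos
      · have hmin : IsLocalMin M x := by
          filter_upwards [hnhds] with u hu
          rw [← hz]; exact h0 u hu
        exact hmin.deriv_eq_zero
      · have hne : G x ≠ M x := fun h => hc ⟨h, hpos⟩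
        have hlt : M x < G x := by
          rcases le_max_iff.1 (hle x hxI) with h | h
          · linarith
          · exact lt_of_le_of_ne h (Ne.symm hne)
        obtain ⟨δ, hδ, hball⟩ := Metric.eventually_nhds_iff.1
          ((hGd.continuousAt.eventually (lt_mem_nhds hlt)).and hnhds)
        -- While `G` stays above `M x` no new minimum is reached. Constancy is shown to the right
        -- only; since `M` is differentiable at `x`, the right derivative suffices.
        have hev : M =ᶠ[𝓝[≥] x] fun _ => M x := by
          have : Ico x (x + δ) ∈ 𝓝[≥] x := Ico_mem_nhdsGE (by linarith)
          filter_upwards [this] with u hu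
          have hin : ∀ v ∈ Icc x u, M x < G v ∧ v ∈ Icc a b := fun v hv => hball (by
            rw [Real.dist_eq, abs_of_nonneg (by linarith [hv.1])]; linarith [hv.2, hu.2])
          have huI := (hin u ⟨hu.1, le_rfl⟩).2
          refine le_antisymm (hanti hxI huI hu.1) ?_
          exact hglb x hxI u huI hu.1 _ le_rfl fun v hv => le_max_of_le_right (hin v hv).1.le
        have hw : HasDerivWithinAt M 0 (Ici x) x :=
          (hasDerivWithinAt_const x (Ici x) (M x)).congr_of_eventuallyEq hev rfl
        exact (uniqueDiffWithinAt_Ici x).eq_deriv _ hM.hasDerivWithinAt hw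
  have := hac.integral_deriv_eq_sub
  rw [intervalIntegral.integral_congr_ae hderiv, intervalIntegral.integral_neg] at this
  linarith

/-! ### Lebesgue measure on the time axis -/

theorem measurableEmbedding_coe_nnreal : MeasurableEmbedding ((↑) : ℝ≥0 → ℝ) :=
  MeasurableEmbedding.subtype_coe measurableSet_Ici

theorem map_coe_dt : dt.map ((↑) : ℝ≥0 → ℝ) = volume.restrict (Ici 0) := by
  rw [dt, measurableEmbedding_coe_nnreal.map_comap, NNReal.range_coe]

instance sigmaFinite_dt : SigmaFinite dt := by
  have : SigmaFinite (dt.map ((↑) : ℝ≥0 → ℝ)) := by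
    rw [map_coe_dt]; infer_instance
  exact SigmaFinite.of_map _ measurableEmbedding_coe_nnreal.measurable.aemeasurable this

theorem preimage_coe_Ioc (s u : ℝ≥0) : ((↑) : ℝ≥0 → ℝ) ⁻¹' Ioc (s : ℝ) u = Ioc s u := by
  ext v; simp

theorem restrict_Ici_restrict_Ioc (s u : ℝ≥0) :
    (volume.restrict (Ici (0 : ℝ))).restrict (Ioc (s : ℝ) u) = volume.restrict (Ioc (s : ℝ) u) := by
  rw [Measure.restrict_restrict measurableSet_Ioc, inter_eq_left.2]
  intro v hv
  exact s.2.trans hv.1.le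

theorem setIntegral_dt_Ioc (g : ℝ≥0 → ℝ) {s u : ℝ≥0} (hsu : s ≤ u) :
    ∫ v in Ioc s u, g v ∂dt = ∫ v in (s : ℝ)..u, g v.toNNReal := by
  rw [intervalIntegral.integral_of_le (by exact_mod_cast hsu), ← restrict_Ici_restrict_Ioc,
    ← map_coe_dt, measurableEmbedding_coe_nnreal.setIntegral_map, preimage_coe_Ioc]
  simp

theorem intervalIntegrable_toNNReal {g : ℝ≥0 → ℝ} (hg : Integrable g dt) (s u : ℝ≥0) :
    IntervalIntegrable (fun v => g v.toNNReal) volume s u := by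
  have h : IntegrableOn (fun v : ℝ => g v.toNNReal) (Ici 0) := by
    rw [IntegrableOn, ← map_coe_dt, measurableEmbedding_coe_nnreal.integrable_map_iff]
    simpa [Function.comp_def] using hg
  rw [intervalIntegrable_iff]
  refine h.mono_set fun v hv => ?_
  rw [uIoc, mem_Ioc] at hv
  exact (le_min s.2 u.2).trans hv.1.le

theorem dt_Ioc (s u : ℝ≥0) : dt (Ioc s u) = ENNReal.ofReal (u - s) := by
  have : dt (Ioc s u) = (dt.map ((↑) : ℝ≥0 → ℝ)) (Ioc (s : ℝ) u) := by
    rw [measurableEmbedding_coe_nnreal.map_apply, preimage_coe_Ioc]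
  rw [this, map_coe_dt, ← Measure.restrict_apply_univ, restrict_Ici_restrict_Ioc,
    Measure.restrict_apply_univ, Real.volume_Ioc]

instance nullSingletonClass_dt : NullSingletonClass dt where
  measure_singleton t := by
    have : dt {t} = (dt.map ((↑) : ℝ≥0 → ℝ)) {(t : ℝ)} := by
      rw [measurableEmbedding_coe_nnreal.map_apply]
      congr 1; ext v; simp
    rw [this, map_coe_dt]
    exact measure_singleton _

/-! ### Paths with finitely many jumps -/

/-- A path started from `x` that decreases at rate `g` and jumps by `-r a` at the times `a ∈ F`. -/
def jumpPath (x : ℝ) (g : ℝ≥0 → ℝ) (F : Finset ℝ≥0) (r : ℝ≥0 → ℝ) (t : ℝ≥0) : ℝ :=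
  x - (∫ s in Ioc 0 t, g s ∂dt) - ∑ a ∈ F with a ≤ t, r a

section jumpPath

variable {x : ℝ} {g : ℝ≥0 → ℝ} {F : Finset ℝ≥0} {r : ℝ≥0 → ℝ}

theorem jumpPath_zero (h0 : 0 ∉ F) : jumpPath x g F r 0 = x := by
  have : F.filter (· ≤ 0) = ∅ := by
    ext a
    simp only [Finset.mem_filter, nonpos_iff_eq_zero, Finset.notMem_empty, iff_false, not_and]
    rintro ha rfl
    exact h0 ha
  simp only [jumpPath, this]
  simp

theorem jumpPath_eq_sub (hg : Integrable g dt) {s u : ℝ≥0} (hsu : s ≤ u)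
    (hF : ∀ a ∈ F, a ∉ Ioc s u) :
    jumpPath x g F r u = jumpPath x g F r s - ∫ v in Ioc s u, g v ∂dt := by
  have h1 : F.filter (· ≤ u) = F.filter (· ≤ s) := by
    refine Finset.filter_congr fun a ha => ⟨fun h => ?_, fun h => h.trans hsu⟩
    by_contra hlt
    exact hF a ha ⟨not_le.1 hlt, h⟩
  have h2 : ∫ v in Ioc 0 u, g v ∂dt = (∫ v in Ioc 0 s, g v ∂dt) + ∫ v in Ioc s u, g v ∂dt := by
    rw [← Ioc_union_Ioc_eq_Ioc zero_le hsu, setIntegral_union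
      (Ioc_disjoint_Ioc_of_le le_rfl) measurableSet_Ioc hg.integrableOn hg.integrableOn]
  simp only [jumpPath, h1, h2]
  ring

theorem continuous_setIntegral_dt (hg : Integrable g dt) :
    Continuous fun t => ∫ s in Ioc 0 t, g s ∂dt := by
  have h : IntegrableOn (fun v : ℝ => g v.toNNReal) (Ici 0) := by
    rw [IntegrableOn, ← map_coe_dt, measurableEmbedding_coe_nnreal.integrable_map_iff]
    simpa [Function.comp_def] using hg
  have h' : Integrable ((Ici (0 : ℝ)).indicator fun v : ℝ => g v.toNNReal) :=
    h.integrable_indicator measurableSet_Ici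
  have hc : Continuous fun t : ℝ≥0 =>
      ∫ v in (0 : ℝ)..t, (Ici (0 : ℝ)).indicator (fun v : ℝ => g v.toNNReal) v := (intervalIntegral.continuous_primitive (fun a b => h'.intervalIntegrable) 0).comp
    NNReal.continuous_coe
  refine hc.congr fun t => ?_
  rw [setIntegral_dt_Ioc g zero_le]
  refine intervalIntegral.integral_congr fun v hv => ?_
  rw [uIcc_of_le (NNReal.coe_nonneg t)] at hv
  exact indicator_of_mem (s := Ici (0 : ℝ)) hv.1 _

/-- Jump times are isolated because `F` is finite: moving slightly away from `t` crosses no jump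
time other than possibly `t` itself. -/
theorem eventually_separated (F : Finset ℝ≥0) (t : ℝ≥0) :
    ∀ᶠ u in 𝓝 t, ∀ a ∈ F, (a < t → a < u) ∧ (t < a → u < a) := by
  rw [eventually_all_finset]
  intro a _
  refine Eventually.and ?_ ?_
  · by_cases h : a < t
    · filter_upwards [lt_mem_nhds h] with u hu _ using hu
    · exact Eventually.of_forall fun u h' => absurd h' h
  · by_cases h : t < a
    · filter_upwards [gt_mem_nhds h] with u hu _ using hu
    · exact Eventually.of_forall fun u h' => absurd h' h

theorem tendsto_jumpPath_right (hg : Integrable g dt) (t : ℝ≥0) :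
    Tendsto (jumpPath x g F r) (𝓝[>] t) (𝓝 (jumpPath x g F r t)) := by
  have hc : Tendsto (fun u => x - (∫ s in Ioc 0 u, g s ∂dt) - ∑ a ∈ F with a ≤ t, r a) (𝓝[>] t)
      (𝓝 (jumpPath x g F r t)) :=
    (((continuous_const.sub (continuous_setIntegral_dt hg)).sub continuous_const).tendsto t).mono_left
      nhdsWithin_le_nhds
  refine hc.congr' ?_
  filter_upwards [self_mem_nhdsWithin, nhdsWithin_le_nhds (eventually_separated F t)] with u hu hsep
  have : F.filter (· ≤ t) = F.filter (· ≤ u) := by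
    refine Finset.filter_congr fun a ha => ⟨fun h => h.trans (le_of_lt hu), fun h => ?_⟩
    by_contra hlt
    exact absurd ((hsep a ha).2 (not_le.1 hlt)) (not_lt.2 h)
  simp only [jumpPath, this]

theorem tendsto_jumpPath_left (hg : Integrable g dt) (t : ℝ≥0) :
    Tendsto (jumpPath x g F r) (𝓝[<] t)
      (𝓝 (jumpPath x g F r t + if t ∈ F then r t else 0)) := by
  have hc : Tendsto (fun u => x - (∫ s in Ioc 0 u, g s ∂dt) - ∑ a ∈ F with a < t, r a) (𝓝[<] t)
      (𝓝 (x - (∫ s in Ioc 0 t, g s ∂dt) - ∑ a ∈ F with a < t, r a)) :=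
    (((continuous_const.sub (continuous_setIntegral_dt hg)).sub continuous_const).tendsto t).mono_left
      nhdsWithin_le_nhds
  have heq : jumpPath x g F r t + (if t ∈ F then r t else 0) =
      x - (∫ s in Ioc 0 t, g s ∂dt) - ∑ a ∈ F with a < t, r a := by
    have : ∑ a ∈ F with a ≤ t, r a = (∑ a ∈ F with a < t, r a) + if t ∈ F then r t else 0 := by
      rw [Finset.sum_filter, Finset.sum_filter, ← Finset.sum_ite_eq' F t r, ← Finset.sum_add_distrib]
      refine Finset.sum_congr rfl fun a _ => ?_
      rcases lt_trichotomy a t with h | h | h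
      · simp [h, h.le, h.ne]
      · simp [h]
      · simp [h.not_ge, h.not_gt, h.ne']
    rw [jumpPath, this]; ring
  rw [heq]
  refine hc.congr' ?_
  filter_upwards [self_mem_nhdsWithin, nhdsWithin_le_nhds (eventually_separated F t)] with u hu hsep
  have : F.filter (· < t) = F.filter (· ≤ u) := by
    refine Finset.filter_congr fun a ha => ⟨fun h => ((hsep a ha).1 h).le, fun h => ?_⟩
    exact lt_of_le_of_lt h hu
  simp only [jumpPath, this]

end jumpPath

/-! ### Running minima and their left limits -/

/-- The running minimum of the positive part of a path. -/
def runningMin (X : ℝ≥0 → ℝ) (t : ℝ≥0) : ℝ := ⨅ s : Iic t, max 0 (X s)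

/-- The left limit of the running minimum of the positive part of a path. -/
def runningMinLeft (X : ℝ≥0 → ℝ) (t : ℝ≥0) : ℝ := ⨅ s : Iio t, max 0 (X s)

section runningMin

variable {X : ℝ≥0 → ℝ}

theorem bddBelow_range_max {ι : Type*} (Y : ι → ℝ) : BddBelow (range fun i => max 0 (Y i)) :=
  ⟨0, by rintro _ ⟨i, rfl⟩; exact le_max_left _ _⟩

theorem runningMin_nonneg (t : ℝ≥0) : 0 ≤ runningMin X t :=
  Real.iInf_nonneg fun _ => le_max_left _ _

theorem runningMin_le {s t : ℝ≥0} (h : s ≤ t) : runningMin X t ≤ max 0 (X s) :=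
  ciInf_le (bddBelow_range_max fun s : Iic t => X s) ⟨s, h⟩

theorem le_runningMin {t : ℝ≥0} {c : ℝ} (h : ∀ s ≤ t, c ≤ max 0 (X s)) : c ≤ runningMin X t := by
  have : Nonempty (Iic t) := ⟨⟨t, le_refl t⟩⟩
  exact le_ciInf fun s => h s s.2

theorem antitone_runningMin : Antitone (runningMin X) := fun _ _ h =>
  le_runningMin fun _ hs => runningMin_le (hs.trans h)

theorem runningMinLeft_le {s t : ℝ≥0} (h : s < t) : runningMinLeft X t ≤ max 0 (X s) :=
  ciInf_le (bddBelow_range_max fun s : Iio t => X s) ⟨s, h⟩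

theorem le_runningMinLeft {t : ℝ≥0} (ht : 0 < t) {c : ℝ} (h : ∀ s < t, c ≤ max 0 (X s)) :
    c ≤ runningMinLeft X t := by
  have : Nonempty (Iio t) := ⟨⟨0, ht⟩⟩
  exact le_ciInf fun s => h s s.2

theorem runningMin_zero : runningMin X 0 = max 0 (X 0) :=
  le_antisymm (runningMin_le le_rfl) (le_runningMin fun s hs => by rw [nonpos_iff_eq_zero.1 hs])

/-- The update rule at time `t`: the past enters only through the left limit. This makes the jumps
of the running minimum expressible by predictable quantities. -/
theorem runningMin_eq_min {t : ℝ≥0} (ht : 0 < t) :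
    runningMin X t = min (runningMinLeft X t) (max 0 (X t)) := by
  refine le_antisymm (le_min (le_runningMinLeft ht fun s hs => runningMin_le hs.le)
    (runningMin_le le_rfl)) (le_runningMin fun s hs => ?_)
  rcases hs.eq_or_lt with rfl | hlt
  · exact min_le_right _ _
  · exact (min_le_left _ _).trans (runningMinLeft_le hlt)

theorem runningMinLeft_le_runningMin {s t : ℝ≥0} (h : s < t) :
    runningMinLeft X t ≤ runningMin X s :=
  le_runningMin fun _ hu => runningMinLeft_le (hu.trans_lt h)

theorem tendsto_runningMin_left {t : ℝ≥0} (ht : 0 < t) :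
    Tendsto (runningMin X) (𝓝[<] t) (𝓝 (runningMinLeft X t)) := by
  refine tendsto_order.2 ⟨fun c hc => ?_, fun c hc => ?_⟩
  · filter_upwards [self_mem_nhdsWithin] with s hs
    exact hc.trans_le (runningMinLeft_le_runningMin hs)
  · obtain ⟨s, hs, hsc⟩ : ∃ s < t, max 0 (X s) < c := by
      by_contra! hcon
      exact absurd (le_runningMinLeft ht hcon) (not_le.2 hc)
    filter_upwards [Ico_mem_nhdsLT hs] with u hu
    exact (runningMin_le hu.1).trans_lt hsc

theorem runningMinLeft_le_of_tendsto {t : ℝ≥0} (ht : 0 < t) {l : ℝ}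
    (hl : Tendsto X (𝓝[<] t) (𝓝 l)) : runningMinLeft X t ≤ max 0 l := by
  have : (𝓝[<] t).NeBot := nhdsLT_neBot_of_exists_lt ⟨0, ht⟩
  refine le_of_tendsto_of_tendsto (tendsto_runningMin_left ht) (tendsto_const_nhds.max hl) ?_
  exact Eventually.of_forall fun s => runningMin_le le_rfl

end runningMin

/-- The running minimum of the positive part of a jump path is again a jump path, whose rate and
jumps are determined by those of the original path and by the left limits. -/
theorem runningMin_eq_jumpPath {x : ℝ} {g : ℝ≥0 → ℝ} {F : Finset ℝ≥0} {r : ℝ≥0 → ℝ} (hx : 0 ≤ x)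
    (hg : Integrable g dt) (hF : 0 ∉ F) {X Xm Mm g' r' : ℝ≥0 → ℝ} (hX : X = jumpPath x g F r)
    (hXm : ∀ t > 0, Tendsto X (𝓝[<] t) (𝓝 (Xm t)))
    (hMm : ∀ t > 0, Mm t = runningMinLeft X t)
    (hg' : ∀ t > 0, g' t = if Xm t = Mm t ∧ 0 < Mm t then max 0 (g t) else 0)
    (hr' : ∀ t ∈ F, r' t = Mm t - min (Mm t) (max 0 (Xm t - r t)))
    (hg'int : Integrable g' dt) (t : ℝ≥0) :
    runningMin X t = jumpPath x g' F r' t := by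
  have hXm' : ∀ t > 0, Xm t = X t + if t ∈ F then r t else 0 := fun t ht => by
    have : (𝓝[<] t).NeBot := nhdsLT_neBot_of_exists_lt ⟨0, ht⟩
    refine tendsto_nhds_unique (hXm t ht) ?_
    rw [hX]; exact tendsto_jumpPath_left hg t
  have hMmle : ∀ t > 0, Mm t ≤ max 0 (Xm t) := fun t ht => by
    rw [hMm t ht]; exact runningMinLeft_le_of_tendsto ht (hXm t ht)
  have hgap : ∀ s u, s ≤ u → (∀ a ∈ F, a ∉ Ioc s u) →
      runningMin X u = runningMin X s - ∫ v in Ioc s u, g' v ∂dt := by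
    intro s u hsu hno
    have hXsub : ∀ v ∈ Icc s u, X v = X s - ∫ w in (s : ℝ)..v, g w.toNNReal := fun v hv => by
      rw [hX, jumpPath_eq_sub hg hv.1 fun a ha h => hno a ha ⟨h.1, h.2.trans hv.2⟩,
        setIntegral_dt_Ioc g hv.1]
    have hmem : ∀ v ∈ Icc (s : ℝ) u, v.toNNReal ∈ Icc s u := fun v hv =>
      ⟨NNReal.le_toNNReal_of_coe_le hv.1, Real.toNNReal_le_iff_le_coe.2 hv.2⟩
    have hcoe : ∀ v ∈ Icc (s : ℝ) u, (v.toNNReal : ℝ) = v := fun v hv =>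
      Real.coe_toNNReal _ (s.2.trans hv.1)
    have key := runningMin_eq_sub_integral (f := fun v : ℝ => g v.toNNReal)
      (G := fun v : ℝ => X v.toNNReal) (M := fun v : ℝ => runningMin X v.toNNReal)
      (a := s) (b := u) (by exact_mod_cast hsu) (intervalIntegrable_toNNReal hg s u)
      (fun v hv => by
        have := hXsub _ (hmem v hv)
        rw [hcoe v hv] at this
        simpa using this)
      (fun v _ => runningMin_nonneg _)
      (fun v _ w _ hvw => antitone_runningMin (Real.toNNReal_mono hvw))
      (fun v _ => runningMin_le le_rfl)
      (fun v hv w hw hvw c hc hcv => le_runningMin fun q hq => by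
        rcases le_total q v.toNNReal with h | h
        · exact hc.trans (runningMin_le h)
        · have := hcv q ⟨Real.toNNReal_le_iff_le_coe.1 h, by
            have : (q : ℝ) ≤ w.toNNReal := by exact_mod_cast hq
            rwa [hcoe w hw] at this⟩
          simpa using this)
    simp only [Real.toNNReal_coe] at key
    rw [key, setIntegral_dt_Ioc g' hsu]
    congr 1
    rw [intervalIntegral.integral_of_le (by exact_mod_cast hsu),
      intervalIntegral.integral_of_le (by exact_mod_cast hsu)]
    refine setIntegral_congr_fun measurableSet_Ioc fun v hv => ?_
    have hv' : v ∈ Icc (s : ℝ) u := Ioc_subset_Icc_self hv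
    have hlt : s < v.toNNReal := Real.lt_toNNReal_iff_coe_lt.2 hv.1
    have hpos : 0 < v.toNNReal := zero_le.trans_lt hlt
    have hvF : v.toNNReal ∉ F := fun h => hno _ h ⟨hlt, (hmem v hv').2⟩
    -- The rate `g'` is written with left limits, the calculus lemma with values; away from the jump
    -- times they coincide.
    have e1 : Xm v.toNNReal = X v.toNNReal := by rw [hXm' _ hpos, if_neg hvF, add_zero]
    have e2 : runningMin X v.toNNReal = Mm v.toNNReal := by
      rw [runningMin_eq_min hpos, ← hMm _ hpos, min_eq_left]
      rw [← e1]; exact hMmle _ hpos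
    simp only [hg' _ hpos, e1, e2]
  set N := jumpPath x g' F r' with hN
  have hNgap : ∀ s u, s ≤ u → (∀ a ∈ F, a ∉ Ioc s u) →
      N u = N s - ∫ v in Ioc s u, g' v ∂dt := fun s u hsu hno => jumpPath_eq_sub hg'int hsu hno
  -- If the two paths agree before `t`, then so do their left limits, and the update rule transfers
  -- the agreement to `t`, whether or not `t` is a jump time.
  have hleft : ∀ t > 0, (∀ s < t, runningMin X s = N s) → runningMin X t = N t := by
    intro t ht heq
    have : (𝓝[<] t).NeBot := nhdsLT_neBot_of_exists_lt ⟨0, ht⟩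
    have h1 : runningMinLeft X t = N t + if t ∈ F then r' t else 0 := by
      refine tendsto_nhds_unique (tendsto_runningMin_left ht) ?_
      refine (tendsto_jumpPath_left hg'int t).congr' ?_
      filter_upwards [self_mem_nhdsWithin] with s hs using (heq s hs).symm
    rw [runningMin_eq_min ht]
    rw [← hMm t ht] at h1 ⊢
    have h2 := hXm' t ht
    have h3 := hMmle t ht
    by_cases htF : t ∈ F
    · rw [if_pos htF] at h1 h2
      rw [hr' t htF] at h1
      have : X t = Xm t - r t := by linarith
      rw [this]; linarith
    · rw [if_neg htF, add_zero] at h1 h2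
      rw [← h2, min_eq_left h3, h1]
  -- Continuous induction on `[0, t]`: `hleft` gives closedness, and `hgap` extends an agreement to
  -- the right up to a time before the next jump.
  have hsub : Icc 0 t ⊆ {t | ∀ s ≤ t, runningMin X s = N s} := by
    refine IsClosed.Icc_subset_of_forall_exists_gt ?_ ?_ ?_
    · refine isClosed_of_closure_subset fun c hc => ?_
      have hc' : c ∈ Icc 0 t := isClosed_Icc.closure_subset (closure_mono inter_subset_right hc)
      refine ⟨?_, hc'⟩
      have hlt : ∀ s < c, runningMin X s = N s := by
        intro s hs
        obtain ⟨q, hq, hqm⟩ := mem_closure_iff_nhds.1 hc _ (lt_mem_nhds hs)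
        exact hqm.1 s (le_of_lt hq)
      intro s hs
      rcases hs.eq_or_lt with rfl | hs
      · rcases eq_zero_or_pos s with rfl | hpos
        · rw [runningMin_zero, hN, hX, jumpPath_zero hF, jumpPath_zero hF, max_eq_right hx]
        · exact hleft s hpos hlt
      · exact hlt s hs
    · intro s hs
      rw [nonpos_iff_eq_zero.1 hs, runningMin_zero, hN, hX, jumpPath_zero hF, jumpPath_zero hF,
        max_eq_right hx]
    · rintro c ⟨hc, -⟩ y hy
      have hev : ∀ᶠ u in 𝓝[>] c, u ∈ Ioc c y ∧ ∀ a ∈ F, (a < c → a < u) ∧ (c < a → u < a) :=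
        (Filter.Eventually.and (Ioc_mem_nhdsGT hy)
          (nhdsWithin_le_nhds (eventually_separated F c)))
      obtain ⟨u, hu, hsep⟩ := hev.exists
      refine ⟨u, fun s hs => ?_, hu⟩
      rcases le_total s c with h | h
      · exact hc s h
      · have hno : ∀ a ∈ F, a ∉ Ioc c s := fun a ha h' =>
          absurd ((hsep a ha).2 h'.1) (not_lt.2 (h'.2.trans hs))
        rw [hgap c s h hno, hNgap c s h hno, hc c le_rfl]
  exact hsub ⟨zero_le, le_refl t⟩ t le_rfl

/-! ### Measurability and predictability -/

/-- Integration of a jointly measurable function against a measurable family of finite measures,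
whose masses need not be uniformly bounded, is measurable. -/
theorem measurable_integral_of_finite {α E : Type*} [MeasurableSpace α] [MeasurableSpace E]
    {K : α → Measure E} (hK : Measurable K) (hfin : ∀ a, K a univ < ∞) {h : α × E → ℝ}
    (hh : Measurable h) : Measurable fun a => ∫ e, h (a, e) ∂(K a) := by
  classical
  have hA : ∀ n : ℕ, MeasurableSet {a | K a univ ≤ n} := fun n =>
    measurableSet_le ((Measure.measurable_coe MeasurableSet.univ).comp hK) measurable_const
  -- Dropping the measures of mass above `n` leaves a finite kernel, and for each fixed `a` the
  -- truncation is eventually inactive.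
  let κ : ℕ → Kernel α E := fun n =>
    ⟨fun a => if K a univ ≤ n then K a else 0, Measurable.ite (hA n) hK measurable_const⟩
  have hκ : ∀ n a, κ n a = if K a univ ≤ n then K a else 0 := fun _ _ => rfl
  have hfinK : ∀ n, IsFiniteKernel (κ n) := fun n => ⟨⟨n, ENNReal.natCast_lt_top n, fun a => by
    rw [hκ]; split_ifs with h
    · exact h
    · simp⟩⟩
  refine measurable_of_tendsto_metrizable (f := fun n a => ∫ e, h (a, e) ∂(κ n a)) (fun n => ?_) ?_
  · exact (hh.stronglyMeasurable.integral_kernel_prod_right' (κ := κ n)).measurable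
  · refine tendsto_pi_nhds.2 fun a => tendsto_const_nhds.congr' ?_
    obtain ⟨N, hN⟩ := ENNReal.exists_nat_gt (hfin a).ne
    filter_upwards [eventually_ge_atTop N] with n hn
    rw [hκ, if_pos (hN.le.trans (by exact_mod_cast hn))]

section

variable {Ω : Type*} [mΩ : MeasurableSpace Ω] {𝓖 : Filtration ℝ≥0 mΩ}

/-- Predictable processes are progressive: composing with `s ↦ min s t` changes nothing on `[0, t]`
and makes the process measurable for the product of the Borel sets with `𝓖 t`. -/
theorem measurable_min_predictable (t : ℝ≥0) :
    @Measurable (ℝ≥0 × Ω) (ℝ≥0 × Ω) (@Prod.instMeasurableSpace _ _ _ (𝓖 t)) 𝓖.predictable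
      fun p => (min p.1 t, p.2) := by
  have h1 : @Measurable (ℝ≥0 × Ω) (Iic t × Ω) (@Prod.instMeasurableSpace _ _ _ (𝓖 t))
      (@Prod.instMeasurableSpace _ _ _ (𝓖 t)) fun p => (⟨min p.1 t, mem_Iic.2 (min_le_right _ _)⟩, p.2) := by
    let _ : MeasurableSpace Ω := 𝓖 t
    exact ((measurable_fst.min measurable_const).subtype_mk).prodMk measurable_snd
  exact (measurable_inclusion_predictable (𝓕 := 𝓖) (i := t)).comp h1

theorem predictable_le : 𝓖.predictable ≤ Prod.instMeasurableSpace := by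
  refine measurableSpace_le_predictable_of_measurableSet (fun A hA => ?_) fun i A hA => ?_
  · exact (measurableSet_singleton _).prod (𝓖.le _ _ hA)
  · exact measurableSet_Ioi.prod (𝓖.le _ _ hA)

theorem measurableSet_predictable_univ_prod {A : Set Ω} (hA : MeasurableSet[𝓖 0] A) :
    MeasurableSet[𝓖.predictable] ((univ : Set ℝ≥0) ×ˢ A) := by
  have : (univ : Set ℝ≥0) ×ˢ A = {⊥} ×ˢ A ∪ Ioi 0 ×ˢ A := by
    rw [← union_prod]
    congr 1
    ext t
    simp
  rw [this]
  exact (measurableSet_predictable_singleton_bot_prod (𝓕 := 𝓖) hA).union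
    (measurableSet_predictable_Ioi_prod hA)

theorem measurableSet_predictable_prod_Ioc {A : Set Ω} (hA : MeasurableSet[𝓖 0] A) (T : ℝ≥0) :
    MeasurableSet[𝓖.predictable] (Ioc 0 T ×ˢ A) :=
  measurableSet_predictable_Ioc_prod 0 T hA

theorem measurable_setIntegral_predictable {ξ : ℝ≥0 → Ω → ℝ}
    (hξ : Measurable[𝓖.predictable] fun p : ℝ≥0 × Ω => ξ p.1 p.2) (t : ℝ≥0) :
    Measurable[𝓖 t] fun ω => ∫ s in Ioc 0 t, ξ s ω ∂dt := by
  have h1 := hξ.comp (measurable_min_predictable (𝓖 := 𝓖) t)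
  have heq : (fun ω => ∫ s in Ioc 0 t, ξ s ω ∂dt) =
      fun ω => ∫ s in Ioc 0 t, ξ (min s t) ω ∂dt := by
    ext ω
    refine setIntegral_congr_fun measurableSet_Ioc fun s hs => ?_
    simp only [min_eq_left hs.2]
  rw [heq]
  let _ : MeasurableSpace Ω := 𝓖 t
  exact (h1.comp measurable_swap).stronglyMeasurable.integral_prod_right'.measurable

theorem measurable_jumpIntegral_predictable {S : Type*} [MeasurableSpace S]
    {K : Ω → Measure (ℝ≥0 × S)} {t : ℝ≥0} (hK : Measurable[𝓖 t] K) (hfin : ∀ ω, K ω univ < ∞)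
    {ρ : ℝ≥0 → Ω → S → ℝ} (hρ : Measurable[predictableProd 𝓖 S] fun p => ρ p.1.1 p.1.2 p.2) :
    Measurable[𝓖 t] fun ω => ∫ p, ρ (min p.1 t) ω p.2 ∂(K ω) := by
  have h1 : @Measurable (Ω × (ℝ≥0 × S)) (ℝ≥0 × Ω)
      (@Prod.instMeasurableSpace _ _ (𝓖 t) _) 𝓖.predictable fun q => (min q.2.1 t, q.1) := by
    have h := measurable_min_predictable (𝓖 := 𝓖) t
    let _ : MeasurableSpace Ω := 𝓖 t
    exact h.comp ((measurable_fst.comp measurable_snd).prodMk measurable_fst)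
  have h2 : @Measurable (Ω × (ℝ≥0 × S)) ((ℝ≥0 × Ω) × S)
      (@Prod.instMeasurableSpace _ _ (𝓖 t) _) (predictableProd 𝓖 S)
      fun q => ((min q.2.1 t, q.1), q.2.2) := by
    have h : @Measurable (Ω × (ℝ≥0 × S)) S (@Prod.instMeasurableSpace _ _ (𝓖 t) _) _
        fun q => q.2.2 := by
      let _ : MeasurableSpace Ω := 𝓖 t
      exact measurable_snd.comp measurable_snd
    exact h1.prodMk h
  have h3 := hρ.comp h2
  let _ : MeasurableSpace Ω := 𝓖 t
  exact measurable_integral_of_finite hK hfin h3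

/-- The grid point of mesh `1 / (n + 1)` that precedes `t`. -/
def gridBefore (n : ℕ) (t : ℝ≥0) : ℝ≥0 := ((⌈(n + 1) * t⌉₊ - 1 : ℕ) : ℝ≥0) / (n + 1)

theorem gridBefore_zero (n : ℕ) : gridBefore n 0 = 0 := by simp [gridBefore]

theorem gridBefore_lt {n : ℕ} {t : ℝ≥0} (ht : 0 < t) : gridBefore n t < t := by
  have hn : (0 : ℝ≥0) < n + 1 := by positivity
  rw [gridBefore, div_lt_iff₀ hn, mul_comm t, ← Nat.lt_ceil]
  have : 0 < ⌈((n : ℝ≥0) + 1) * t⌉₊ := Nat.ceil_pos.2 (by positivity)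
  omega

theorem le_gridBefore_add (n : ℕ) (t : ℝ≥0) : t ≤ gridBefore n t + 1 / (n + 1) := by
  have hn : (0 : ℝ≥0) < n + 1 := by positivity
  rw [gridBefore, ← add_div, le_div_iff₀ hn, mul_comm t]
  refine (Nat.le_ceil _).trans ?_
  have : ⌈((n : ℝ≥0) + 1) * t⌉₊ ≤ (⌈((n : ℝ≥0) + 1) * t⌉₊ - 1) + 1 := by omega
  exact_mod_cast this

theorem tendsto_gridBefore {t : ℝ≥0} (ht : 0 < t) :
    Tendsto (fun n => gridBefore n t) atTop (𝓝[<] t) := by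
  refine tendsto_nhdsWithin_iff.2 ⟨?_, Eventually.of_forall fun n => gridBefore_lt ht⟩
  have h1 : Tendsto (fun n : ℕ => t - 1 / ((n : ℝ≥0) + 1)) atTop (𝓝 t) := by
    have h := tendsto_one_div_add_atTop_nhds_zero_nat (𝕜 := ℝ)
    have h' : Tendsto (fun n : ℕ => 1 / ((n : ℝ≥0) + 1)) atTop (𝓝 0) := by
      rw [← NNReal.tendsto_coe]; simpa using h
    simpa using (tendsto_const_nhds (x := t)).sub h'
  refine tendsto_of_tendsto_of_tendsto_of_le_of_le h1 tendsto_const_nhds (fun n => ?_)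
    fun n => (gridBefore_lt ht).le
  exact tsub_le_iff_right.2 (le_gridBefore_add n t)

/-- On each cell `(k/(n+1), (k+1)/(n+1)]` the process is frozen at its value at the left endpoint,
so preimages are countable unions of predictable rectangles, time `0` being a separate generator. -/
theorem measurable_gridBefore_predictable {X : ℝ≥0 → Ω → ℝ} (hX : ∀ t, Measurable[𝓖 t] (X t))
    (n : ℕ) : Measurable[𝓖.predictable] fun p : ℝ≥0 × Ω => X (gridBefore n p.1) p.2 := by
  intro A hA
  have hn : (0 : ℝ≥0) < n + 1 := by positivity
  have heq : (fun p : ℝ≥0 × Ω => X (gridBefore n p.1) p.2) ⁻¹' A =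
      {⊥} ×ˢ (X 0 ⁻¹' A) ∪ ⋃ k : ℕ,
        Ioc ((k : ℝ≥0) / (n + 1)) ((k + 1 : ℝ≥0) / (n + 1)) ×ˢ (X ((k : ℝ≥0) / (n + 1)) ⁻¹' A) := by
    ext ⟨t, ω⟩
    simp only [mem_preimage, mem_union, mem_prod, mem_singleton_iff, bot_eq_zero', mem_iUnion]
    have hval : ∀ k : ℕ, t ∈ Ioc ((k : ℝ≥0) / (n + 1)) ((k + 1 : ℝ≥0) / (n + 1)) →
        gridBefore n t = (k : ℝ≥0) / (n + 1) := by
      intro k hk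
      have h1 : ⌈((n : ℝ≥0) + 1) * t⌉₊ = k + 1 := by
        rw [Nat.ceil_eq_iff (by omega)]
        have h1 := hk.1
        have h2 := hk.2
        rw [div_lt_iff₀ hn, mul_comm t] at h1
        rw [le_div_iff₀ hn, mul_comm t] at h2
        exact ⟨by simpa using h1, by simpa using h2⟩
      rw [gridBefore, h1]; simp
    constructor
    · intro h
      rcases eq_zero_or_pos t with rfl | ht
      · left; rw [gridBefore_zero] at h; exact ⟨rfl, h⟩
      · right
        refine ⟨⌈((n : ℝ≥0) + 1) * t⌉₊ - 1, ⟨gridBefore_lt ht, ?_⟩, h⟩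
        have := le_gridBefore_add n t
        rwa [gridBefore, ← add_div] at this
    · rintro (⟨rfl, h⟩ | ⟨k, hk, h⟩)
      · rwa [gridBefore_zero]
      · rwa [hval k hk]
  rw [heq]
  refine MeasurableSet.union (measurableSet_predictable_singleton_bot_prod (𝓕 := 𝓖) (hX 0 hA)) ?_
  exact MeasurableSet.iUnion fun k => measurableSet_predictable_Ioc_prod _ _ (hX _ hA)

/-- The left limits of an adapted process with left limits form a predictable process. -/
theorem measurable_leftLim_predictable {X : ℝ≥0 → Ω → ℝ} (hX : ∀ t, Measurable[𝓖 t] (X t))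
    (hlim : ∀ t > 0, ∀ ω, ∃ l, Tendsto (fun s => X s ω) (𝓝[<] t) (𝓝 l)) :
    Measurable[𝓖.predictable] fun p : ℝ≥0 × Ω => Function.leftLim (fun s => X s p.2) p.1 := by
  refine @measurable_of_tendsto_metrizable _ _ 𝓖.predictable _ _ _ _
    (fun n p => X (gridBefore n p.1) p.2) _ (measurable_gridBefore_predictable hX) ?_
  refine tendsto_pi_nhds.2 fun ⟨t, ω⟩ => ?_
  rcases eq_zero_or_pos t with rfl | ht
  -- At time `0` there is nothing to the left, and `leftLim` takes the value of the function by
  -- convention.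
  · have : 𝓝[<] (0 : ℝ≥0) = ⊥ := by simp
    simp only [gridBefore_zero, leftLim_eq_of_eq_bot _ this]
    exact tendsto_const_nhds
  · obtain ⟨l, hl⟩ := hlim t ht ω
    exact (tendsto_leftLim_of_tendsto (f := fun s => X s ω) ⟨l, hl⟩).comp (tendsto_gridBefore ht)

/-- A value at `s < t` is approximated, by right-continuity, at points of the dense sequence in `(s,
t)`. Indices whose point is not before `t` contribute `X 0`, which is harmless as `0 < t`. -/
theorem runningMinLeft_eq_iInf_denseSeq {X : ℝ≥0 → ℝ}
    (hX : ∀ t, Tendsto X (𝓝[>] t) (𝓝 (X t))) {t : ℝ≥0} (ht : 0 < t) :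
    runningMinLeft X t = ⨅ n : ℕ, max 0
      (if TopologicalSpace.denseSeq ℝ≥0 n < t then X (TopologicalSpace.denseSeq ℝ≥0 n) else X 0) := by
  refine le_antisymm (le_ciInf fun n => ?_) (le_runningMinLeft ht fun s hs => ?_)
  · split_ifs with h
    · exact runningMinLeft_le h
    · exact runningMinLeft_le ht
  · by_contra! hlt
    have hev : ∀ᶠ u in 𝓝[>] s, max 0 (X u) < ⨅ n : ℕ, max 0
        (if TopologicalSpace.denseSeq ℝ≥0 n < t then X (TopologicalSpace.denseSeq ℝ≥0 n)
          else X 0) :=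
      ((tendsto_const_nhds (x := (0 : ℝ))).max (hX s)).eventually (gt_mem_nhds hlt)
    obtain ⟨u, hu, hsub⟩ := (mem_nhdsGT_iff_exists_Ioo_subset' hs).1
      (hev.and (Ioo_mem_nhdsGT hs))
    obtain ⟨q, hq, n, rfl⟩ := (TopologicalSpace.denseRange_denseSeq ℝ≥0).exists_mem_open isOpen_Ioo
      (nonempty_Ioo.2 hu) |>.imp fun n hn => (⟨hn, n, rfl⟩ : _ ∧ ∃ m, m = n)
    have h1 := hsub hq
    have h2 := ciInf_le (bddBelow_range_max fun n : ℕ =>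
      if TopologicalSpace.denseSeq ℝ≥0 n < t then X (TopologicalSpace.denseSeq ℝ≥0 n) else X 0) n
    rw [if_pos h1.2.2] at h2
    exact absurd h1.1 (not_lt.2 h2)

/-- A real infimum over the empty set is `0` by convention. This default makes `minRate` and
`minJump` vanish at time `0`. -/
theorem runningMinLeft_zero (X : ℝ≥0 → ℝ) : runningMinLeft X 0 = 0 := by
  have : IsEmpty (Iio (0 : ℝ≥0)) := ⟨fun s => absurd (mem_Iio.1 s.2) not_lt_zero⟩
  exact Real.iInf_of_isEmpty _

/-- The left limit of the running minimum of an adapted right-continuous process is predictable. -/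
theorem measurable_runningMinLeft_predictable {X : ℝ≥0 → Ω → ℝ}
    (hX : ∀ t, Measurable[𝓖 t] (X t))
    (hright : ∀ t ω, Tendsto (fun s => X s ω) (𝓝[>] t) (𝓝 (X t ω))) :
    Measurable[𝓖.predictable] fun p : ℝ≥0 × Ω => runningMinLeft (fun s => X s p.2) p.1 := by
  classical
  have hset : ∀ (s : ℝ≥0) (A : Set Ω), MeasurableSet[𝓖 s] A →
      MeasurableSet[𝓖.predictable] (Ioi s ×ˢ A) := fun s A hA =>
    measurableSet_predictable_Ioi_prod hA
  have h0 : Measurable[𝓖.predictable] fun p : ℝ≥0 × Ω => X 0 p.2 := fun A hA => by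
    have := measurableSet_predictable_univ_prod (𝓖 := 𝓖) (hX 0 hA)
    rwa [univ_prod] at this
  -- A single sampled value, used only strictly after the sampling time, is predictable; the infimum
  -- over countably many of them stays so.
  have hn : ∀ s : ℝ≥0, Measurable[𝓖.predictable] fun p : ℝ≥0 × Ω =>
      if s < p.1 then X s p.2 else X 0 p.2 := by
    intro s A hA
    have : (fun p : ℝ≥0 × Ω => if s < p.1 then X s p.2 else X 0 p.2) ⁻¹' A =
        Ioi s ×ˢ (X s ⁻¹' A) ∪ ((fun p : ℝ≥0 × Ω => X 0 p.2) ⁻¹' A \ Ioi s ×ˢ univ) := by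
      ext ⟨t, ω⟩
      by_cases h : s < t <;> simp [h]
    rw [this]
    exact (hset s _ (hX s hA)).union ((h0 hA).diff (hset s _ MeasurableSet.univ))
  have hinf : Measurable[𝓖.predictable] fun p : ℝ≥0 × Ω => ⨅ n : ℕ, max 0
      (if TopologicalSpace.denseSeq ℝ≥0 n < p.1 then X (TopologicalSpace.denseSeq ℝ≥0 n) p.2
        else X 0 p.2) := by
    let _ : MeasurableSpace (ℝ≥0 × Ω) := 𝓖.predictable
    exact Measurable.iInf fun n => measurable_const.max (hn _)
  have heq : (fun p : ℝ≥0 × Ω => runningMinLeft (fun s => X s p.2) p.1) =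
      (Ioi (0 : ℝ≥0) ×ˢ (univ : Set Ω)).indicator fun p : ℝ≥0 × Ω => ⨅ n : ℕ, max 0
      (if TopologicalSpace.denseSeq ℝ≥0 n < p.1 then X (TopologicalSpace.denseSeq ℝ≥0 n) p.2
        else X 0 p.2) := by
    ext ⟨t, ω⟩
    rcases eq_zero_or_pos t with rfl | ht
    · simp [runningMinLeft_zero]
    · rw [indicator_of_mem (by simpa using ht)]
      exact runningMinLeft_eq_iInf_denseSeq (fun s => hright s ω) ht
  rw [heq]
  exact hinf.indicator (hset 0 _ MeasurableSet.univ)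

end

/-! ### Counting measures of point functions -/

section jumpMeasure

variable {S : Type*} [MeasurableSpace S] {p : ℝ≥0 → Option S}

theorem jumpMeasure_apply {A : Set (ℝ≥0 × S)} (hA : MeasurableSet A) :
    jumpMeasure p A = ∑' i : {a : ℝ≥0 × S // p a.1 = some a.2}, A.indicator 1 (i : ℝ≥0 × S) := by
  rw [jumpMeasure, Measure.sum_apply _ hA]
  exact tsum_congr fun i => Measure.dirac_apply' _ hA

/-- Every point carries mass one, so finite total mass leaves room for finitely many points only. -/
theorem finite_jumpTimes {A : Set ℝ≥0} (hA : MeasurableSet A)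
    (hfin : jumpMeasure p (A ×ˢ univ) < ∞) : {t | t ∈ A ∧ p t ≠ none}.Finite := by
  rw [jumpMeasure_apply (hA.prod MeasurableSet.univ)] at hfin
  refine ((ENNReal.finite_const_le_of_tsum_ne_top hfin.ne one_ne_zero).image
    fun i : {a : ℝ≥0 × S // p a.1 = some a.2} => (i : ℝ≥0 × S).1).subset ?_
  rintro t ⟨htA, ht⟩
  obtain ⟨z, hz⟩ := Option.ne_none_iff_exists'.1 ht
  exact ⟨⟨(t, z), hz⟩, by simp [htA], rfl⟩

/-- A counting measure restricted to a time window that contains finitely many jumps is a finite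
sum of Dirac masses. -/
theorem jumpMeasure_restrict_eq_sum {A : Set ℝ≥0} (hA : MeasurableSet A) {F : Finset ℝ≥0}
    (hF : ∀ t, t ∈ F ↔ t ∈ A ∧ p t ≠ none) :
    (jumpMeasure p).restrict (A ×ˢ univ) =
      ∑ a ∈ F, (p a).elim 0 fun z => Measure.dirac (a, z) := by
  ext s hs
  have hs' : MeasurableSet (s ∩ A ×ˢ univ) := hs.inter (hA.prod MeasurableSet.univ)
  rw [Measure.restrict_apply hs, jumpMeasure_apply hs', Measure.finsetSum_apply]
  let φ : ℝ≥0 → ℝ≥0∞ := fun a => (p a).elim 0 fun z => (s ∩ A ×ˢ univ).indicator 1 (a, z)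
  have h1 : ∀ i : {a : ℝ≥0 × S // p a.1 = some a.2},
      (s ∩ A ×ˢ univ).indicator (1 : ℝ≥0 × S → ℝ≥0∞) (i : ℝ≥0 × S) = φ (i : ℝ≥0 × S).1 := by
    rintro ⟨⟨a, z⟩, h⟩
    simp only [φ] at h ⊢
    rw [h]; rfl
  -- At most one point occurs at each time, so the atoms can be indexed by their times and the sum
  -- over atoms becomes a sum over `F`.
  have hinj : Function.Injective
      fun i : {a : ℝ≥0 × S // p a.1 = some a.2} => (i : ℝ≥0 × S).1 := by
    rintro ⟨⟨a, z⟩, h⟩ ⟨⟨a', z'⟩, h'⟩ (rfl : a = a')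
    simp only at h h'
    rw [h, Option.some_inj] at h'
    subst h'; rfl
  rw [tsum_congr h1, hinj.tsum_eq (f := φ), tsum_eq_sum (s := F)]
  · refine Finset.sum_congr rfl fun a ha => ?_
    obtain ⟨haA, hp⟩ := (hF a).1 ha
    obtain ⟨z, hz⟩ := Option.ne_none_iff_exists'.1 hp
    simp only [φ, hz, Option.elim_some]
    rw [Measure.dirac_apply' _ hs]
    by_cases h : (a, z) ∈ s
    · rw [indicator_of_mem h, indicator_of_mem (show (a, z) ∈ s ∩ A ×ˢ univ from ⟨h, haA, mem_univ _⟩)]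
    · rw [indicator_of_notMem h, indicator_of_notMem fun h' => h h'.1]
  · intro a ha
    rcases hz : p a with _ | z
    · simp [φ, hz]
    · simp only [φ, hz, Option.elim_some]
      refine indicator_of_notMem (fun h => ha ((hF a).2 ⟨h.2.1, by simp [hz]⟩)) _
  · intro a ha
    rcases hz : p a with _ | z
    · simp [φ, hz] at ha
    · exact ⟨⟨(a, z), hz⟩, rfl⟩

theorem setIntegral_jumpMeasure [MeasurableSingletonClass S] {A : Set ℝ≥0} (hA : MeasurableSet A)
    {F : Finset ℝ≥0} (hF : ∀ t, t ∈ F ↔ t ∈ A ∧ p t ≠ none) (h : ℝ≥0 → S → ℝ) :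
    ∫ q in A ×ˢ univ, h q.1 q.2 ∂(jumpMeasure p) = ∑ a ∈ F, (p a).elim 0 (h a) := by
  rw [jumpMeasure_restrict_eq_sum hA hF, integral_finsetSum_measure]
  · refine Finset.sum_congr rfl fun a _ => ?_
    cases p a with
    | none => simp
    | some z => simp [integral_dirac]
  · intro a _
    cases p a with
    | none => simp
    | some z => exact integrable_dirac (by simp)

/-- If the integrand vanishes outside a window with finitely many jumps, its integral against the
counting measure is a finite sum over the jump times. -/
theorem setIntegral_Ioc_jumpMeasure [MeasurableSingletonClass S] {T : ℝ≥0} {F : Finset ℝ≥0}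
    (hF : ∀ t, t ∈ F ↔ t ∈ Ioc 0 T ∧ p t ≠ none) {h : ℝ≥0 → S → ℝ}
    (hh : ∀ t, t ∉ Ioc 0 T → ∀ z, h t z = 0) (t : ℝ≥0) :
    ∫ q in Ioc 0 t ×ˢ univ, h q.1 q.2 ∂(jumpMeasure p) =
      ∑ a ∈ F with a ≤ t, (p a).elim 0 (h a) := by
  have h1 : ∫ q in Ioc 0 t ×ˢ univ, h q.1 q.2 ∂(jumpMeasure p) =
      ∫ q in Ioc 0 (min t T) ×ˢ univ, h q.1 q.2 ∂(jumpMeasure p) := by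
    refine setIntegral_eq_of_subset_of_forall_sdiff_eq_zero
      (measurableSet_Ioc.prod MeasurableSet.univ)
      (prod_mono_left (Ioc_subset_Ioc_right (min_le_left _ _))) fun q hq => hh _ (fun h => hq.2 ?_) _
    exact ⟨⟨h.1, le_min hq.1.1.2 h.2⟩, mem_univ _⟩
  rw [h1]
  refine setIntegral_jumpMeasure measurableSet_Ioc (fun a => ?_) h
  rw [Finset.mem_filter, hF, mem_Ioc, mem_Ioc, le_min_iff]
  tauto

end jumpMeasure

/-! ### Poisson counts -/

section poisson

variable {Ω S : Type*} [mΩ : MeasurableSpace Ω] [MeasurableSpace S] {J : ℝ≥0 → Ω → Option S}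
  {μ : Measure S} [IsFiniteMeasure μ] {P : Measure Ω}

theorem dt_prod_Ioc (s t : ℝ≥0) :
    (dt.prod μ) (Ioc s t ×ˢ univ) = ENNReal.ofReal (t - s) * μ univ := by
  rw [Measure.prod_prod, dt_Ioc]

theorem dt_prod_Ioc_ne_top (s t : ℝ≥0) : (dt.prod μ) (Ioc s t ×ˢ univ) ≠ ∞ := by
  rw [dt_prod_Ioc]
  exact ENNReal.mul_ne_top ENNReal.ofReal_ne_top (measure_ne_top _ _)

theorem IsPoissonPointProcess.ae_lt_top (hJ : IsPoissonPointProcess J μ P) (T : ℝ≥0) :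
    ∀ᵐ ω ∂P, jumpMeasure (fun r => J r ω) (Ioc 0 T ×ˢ univ) < ∞ := by
  have h := hJ.law (Ioc 0 T ×ˢ univ) (measurableSet_Ioc.prod MeasurableSet.univ)
    (dt_prod_Ioc_ne_top 0 T)
  have hmeas : MeasurableSet {a : ℝ≥0∞ | a < ∞} := measurableSet_Iio
  rw [← ae_map_iff (p := fun a => a < ∞) h.aemeasurable hmeas, h.map_eq,
    ae_map_iff (Measurable.of_discrete).aemeasurable hmeas]
  exact Eventually.of_forall fun n => ENNReal.natCast_lt_top n

theorem IsPoissonPointProcess.measure_no_jump (hJ : IsPoissonPointProcess J μ P) (s t : ℝ≥0) :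
    P {ω | jumpMeasure (fun r => J r ω) (Ioc s t ×ˢ univ) = 0} =
      ENNReal.ofReal (Real.exp (-((dt.prod μ) (Ioc s t ×ˢ univ)).toReal)) := by
  have h := hJ.law (Ioc s t ×ˢ univ) (measurableSet_Ioc.prod MeasurableSet.univ)
    (dt_prod_Ioc_ne_top s t)
  have h1 : P {ω | jumpMeasure (fun r => J r ω) (Ioc s t ×ˢ univ) = 0} =
      (P.map fun ω => jumpMeasure (fun r => J r ω) (Ioc s t ×ˢ univ)) {0} := by
    rw [Measure.map_apply_of_aemeasurable h.aemeasurable (measurableSet_singleton _)]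
    rfl
  have h2 : (Nat.cast : ℕ → ℝ≥0∞) ⁻¹' {0} = {0} := by ext n; simp
  rw [h1, h.map_eq, Measure.map_apply Measurable.of_discrete (measurableSet_singleton _), h2,
    poissonMeasure_singleton]
  simp [ENNReal.toReal]

end poisson

/-! ### The control realizing the running minimum -/

section minControl

variable {Ω S : Type*}

/-- The trading rate that realizes the running minimum of the positive part of `X`. -/
def minRate (X ξ : ℝ≥0 → Ω → ℝ) (t : ℝ≥0) (ω : Ω) : ℝ :=
  open Classical in
  if Function.leftLim (fun s => X s ω) t = runningMinLeft (fun s => X s ω) t ∧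
    0 < runningMinLeft (fun s => X s ω) t then max 0 (ξ t ω) else 0

/-- The jumps that realize the running minimum of the positive part of `X`. -/
def minJump (X : ℝ≥0 → Ω → ℝ) (ρ : ℝ≥0 → Ω → S → ℝ) (t : ℝ≥0) (ω : Ω) (z : S) : ℝ :=
  runningMinLeft (fun s => X s ω) t - min (runningMinLeft (fun s => X s ω) t)
    (max 0 (Function.leftLim (fun s => X s ω) t - ρ t ω z))

theorem minRate_nonneg (X ξ : ℝ≥0 → Ω → ℝ) (t : ℝ≥0) (ω : Ω) : 0 ≤ minRate X ξ t ω := by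
  rw [minRate]
  split_ifs
  exacts [le_max_left _ _, le_rfl]

theorem abs_minRate_le (X ξ : ℝ≥0 → Ω → ℝ) (t : ℝ≥0) (ω : Ω) :
    |minRate X ξ t ω| ≤ |ξ t ω| := by
  rw [abs_of_nonneg (minRate_nonneg X ξ t ω), minRate]
  split_ifs
  exacts [max_le (abs_nonneg _) (le_abs_self _), abs_nonneg _]

/-- The positive part is 1-Lipschitz, so `(X_- - ρ)⁺ ≥ X_-⁺ - |ρ| ≥ M_- - |ρ|`: the minimum drops by
at most `|ρ|`. -/
theorem abs_minJump_le {X : ℝ≥0 → Ω → ℝ} (ρ : ℝ≥0 → Ω → S → ℝ) {t : ℝ≥0} {ω : Ω}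
    (hX : runningMinLeft (fun s => X s ω) t ≤ max 0 (Function.leftLim (fun s => X s ω) t)) (z : S) :
    |minJump X ρ t ω z| ≤ |ρ t ω z| := by
  have h1 : 0 ≤ minJump X ρ t ω z := sub_nonneg.2 (min_le_left _ _)
  rw [abs_of_nonneg h1, minJump, sub_le_comm]
  refine le_min (by linarith [abs_nonneg (ρ t ω z)]) ?_
  rcases le_max_iff.1 hX with h | h
  · exact le_max_of_le_left (by linarith [abs_nonneg (ρ t ω z)])
  · exact le_max_of_le_right (by linarith [le_abs_self (ρ t ω z)])

end minControl

section control

variable {Ω S : Type*} [mΩ : MeasurableSpace Ω] [MeasurableSpace S] {P : Measure Ω}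
  {𝓖 : Filtration ℝ≥0 mΩ} {T : ℝ≥0} {J : ℝ≥0 → Ω → Option S}

/-- A predictable control that vanishes outside `(0, T] × A`, where `A` is an event known at time
`0` on which there are finitely many jumps and the trading rate is square integrable. -/
structure IsLocalizedControl (𝓖 : Filtration ℝ≥0 mΩ) (T : ℝ≥0) (J : ℝ≥0 → Ω → Option S)
    (A : Set Ω) (ξ : ℝ≥0 → Ω → ℝ) (ρ : ℝ≥0 → Ω → S → ℝ) : Prop where
  measurableSet : MeasurableSet[𝓖 0] A
  finite : ∀ ω ∈ A, jumpMeasure (fun r => J r ω) (Ioc 0 T ×ˢ univ) < ∞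
  measurable_ξ : Measurable[𝓖.predictable] fun p : ℝ≥0 × Ω => ξ p.1 p.2
  measurable_ρ : Measurable[predictableProd 𝓖 S] fun p => ρ p.1.1 p.1.2 p.2
  ξ_eq_zero : ∀ t ω, (t, ω) ∉ Ioc 0 T ×ˢ A → ξ t ω = 0
  ρ_eq_zero : ∀ t ω, (t, ω) ∉ Ioc 0 T ×ˢ A → ∀ z, ρ t ω z = 0
  integrable : ∀ ω, Integrable (fun t => ξ t ω) dt

namespace IsLocalizedControl

variable {A : Set Ω} {ξ : ℝ≥0 → Ω → ℝ} {ρ : ℝ≥0 → Ω → S → ℝ} {x : ℝ}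

/-- The paths of the state process of a localized control are jump paths, with jump times that do
not depend on the control. -/
theorem exists_jumpTimes [MeasurableSingletonClass S] (h : IsLocalizedControl 𝓖 T J A ξ ρ)
    (ω : Ω) : ∃ F : Finset ℝ≥0, 0 ∉ F ∧ ∀ ξ' ρ',
      (∀ t, (t, ω) ∉ Ioc 0 T ×ˢ A → ∀ z, ρ' t ω z = 0) →
      (fun t => state J x ξ' ρ' t ω) =
        jumpPath x (fun t => ξ' t ω) F fun a => (J a ω).elim 0 (ρ' a ω) := by
  by_cases hω : ω ∈ A
  · have hfin := finite_jumpTimes measurableSet_Ioc (h.finite ω hω)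
    have hF : ∀ t, t ∈ hfin.toFinset ↔ t ∈ Ioc 0 T ∧ J t ω ≠ none := fun t => by simp
    refine ⟨hfin.toFinset, fun h0 => lt_irrefl _ ((hF 0).1 h0).1.1, fun ξ' ρ' hρ' => ?_⟩
    ext t
    rw [state, jumpPath, setIntegral_Ioc_jumpMeasure hF fun t ht => hρ' t fun h' => ht h'.1]
  · refine ⟨∅, Finset.notMem_empty _, fun ξ' ρ' hρ' => ?_⟩
    have hz : ∀ t z, ρ' t ω z = 0 := fun t => hρ' t fun h' => hω h'.2
    ext t
    simp [state, jumpPath, hz]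

theorem measurable_state (h : IsLocalizedControl 𝓖 T J A ξ ρ)
    (hJ : IsCompatiblePoint J 𝓖 T P) (t : ℝ≥0) : Measurable[𝓖 t] (state J x ξ ρ t) := by
  classical
  -- Adaptedness of the jumps is available up to `T` only, whence `min t T`; nothing is lost since
  -- `ρ` vanishes after `T`. Setting `K` to zero off `A` makes its mass finite for every `ω`.
  let K : Ω → Measure (ℝ≥0 × S) := fun ω => if ω ∈ A then
    (jumpMeasure fun r => J r ω).restrict (Ioc 0 (min t T) ×ˢ univ) else 0
  have hK : Measurable[𝓖 t] K := by
    have hA := 𝓖.mono (zero_le (a := t)) _ h.measurableSet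
    have h1 := (hJ.adapted (min t T) (min_le_right _ _)).mono (𝓖.mono (min_le_left _ _)) le_rfl
    let _ : MeasurableSpace Ω := 𝓖 t
    exact Measurable.ite hA h1 measurable_const
  have hfin : ∀ ω, K ω univ < ∞ := fun ω => by
    by_cases hω : ω ∈ A
    · simp only [K, if_pos hω, Measure.restrict_apply_univ]
      exact (measure_mono (prod_mono_left (Ioc_subset_Ioc_right (min_le_right _ _)))).trans_lt
        (h.finite ω hω)
    · simp [K, hω]
  have h1 := measurable_jumpIntegral_predictable hK hfin h.measurable_ρ
  have h2 : (fun ω => ∫ p in Ioc 0 t ×ˢ univ, ρ p.1 ω p.2 ∂(jumpMeasure fun r => J r ω)) =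
      fun ω => ∫ p, ρ (min p.1 t) ω p.2 ∂(K ω) := by
    ext ω
    by_cases hω : ω ∈ A
    · simp only [K, if_pos hω]
      have e1 : ∫ p in Ioc 0 (min t T) ×ˢ univ, ρ (min p.1 t) ω p.2 ∂(jumpMeasure fun r => J r ω) =
          ∫ p in Ioc 0 (min t T) ×ˢ univ, ρ p.1 ω p.2 ∂(jumpMeasure fun r => J r ω) := by
        refine setIntegral_congr_fun (measurableSet_Ioc.prod MeasurableSet.univ) fun p hp => ?_
        simp only [min_eq_left (hp.1.2.trans (min_le_left _ _))]
      rw [e1]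
      refine setIntegral_eq_of_subset_of_forall_sdiff_eq_zero
        (measurableSet_Ioc.prod MeasurableSet.univ)
        (prod_mono_left (Ioc_subset_Ioc_right (min_le_left _ _)))
        fun q hq => h.ρ_eq_zero _ _ (fun h' => hq.2 ?_) _
      exact ⟨⟨h'.1.1, le_min hq.1.1.2 h'.1.2⟩, mem_univ _⟩
    · have hz : ∀ t z, ρ t ω z = 0 := fun t => h.ρ_eq_zero t ω fun h' => hω h'.2
      simp [hz]
  have h3 := measurable_setIntegral_predictable h.measurable_ξ t
  have h4 : state J x ξ ρ t = fun ω => x - (∫ s in Ioc 0 t, ξ s ω ∂dt) -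
      ∫ p, ρ (min p.1 t) ω p.2 ∂(K ω) := by
    ext ω
    rw [state, congrFun h2 ω]
  rw [h4]
  let _ : MeasurableSpace Ω := 𝓖 t
  exact (measurable_const.sub h3).sub h1

end IsLocalizedControl

namespace IsLocalizedControl

variable [MeasurableSingletonClass S] {A : Set Ω} {ξ : ℝ≥0 → Ω → ℝ} {ρ : ℝ≥0 → Ω → S → ℝ} {x : ℝ}

theorem tendsto_state_left (h : IsLocalizedControl 𝓖 T J A ξ ρ) {t : ℝ≥0} (ω : Ω) :
    ∃ l, Tendsto (fun s => state J x ξ ρ s ω) (𝓝[<] t) (𝓝 l) := by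
  obtain ⟨F, -, hF⟩ := h.exists_jumpTimes (x := x) ω
  rw [hF ξ ρ fun t => h.ρ_eq_zero t ω]
  exact ⟨_, tendsto_jumpPath_left (h.integrable ω) t⟩

theorem tendsto_state_right (h : IsLocalizedControl 𝓖 T J A ξ ρ) (t : ℝ≥0) (ω : Ω) :
    Tendsto (fun s => state J x ξ ρ s ω) (𝓝[>] t) (𝓝 (state J x ξ ρ t ω)) := by
  obtain ⟨F, -, hF⟩ := h.exists_jumpTimes (x := x) ω
  have := hF ξ ρ fun t => h.ρ_eq_zero t ω
  rw [this, congrFun this t]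
  exact tendsto_jumpPath_right (h.integrable ω) t

theorem runningMinLeft_le_leftLim (h : IsLocalizedControl 𝓖 T J A ξ ρ) (t : ℝ≥0) (ω : Ω) :
    runningMinLeft (fun s => state J x ξ ρ s ω) t ≤
      max 0 (Function.leftLim (fun s => state J x ξ ρ s ω) t) := by
  rcases eq_zero_or_pos t with rfl | ht
  · rw [runningMinLeft_zero]; exact le_max_left _ _
  · exact runningMinLeft_le_of_tendsto ht (tendsto_leftLim_of_tendsto (h.tendsto_state_left ω))

theorem measurable_minRate (h : IsLocalizedControl 𝓖 T J A ξ ρ) (hJ : IsCompatiblePoint J 𝓖 T P) :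
    Measurable[𝓖.predictable] fun p : ℝ≥0 × Ω => minRate (state J x ξ ρ) ξ p.1 p.2 := by
  have hL := measurable_leftLim_predictable (h.measurable_state (x := x) hJ)
    fun t _ ω => h.tendsto_state_left ω
  have hM := measurable_runningMinLeft_predictable (h.measurable_state (x := x) hJ)
    h.tendsto_state_right
  have hξ := h.measurable_ξ
  let _ : MeasurableSpace (ℝ≥0 × Ω) := 𝓖.predictable
  classical
  exact Measurable.ite ((measurableSet_eq_fun hL hM).inter
    (measurableSet_lt measurable_const hM)) (measurable_const.max hξ) measurable_const

/-- Replacing the controls by `minRate` and `minJump` is again a localized control. -/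
theorem minControl (h : IsLocalizedControl 𝓖 T J A ξ ρ) (hJ : IsCompatiblePoint J 𝓖 T P) :
    IsLocalizedControl 𝓖 T J A (minRate (state J x ξ ρ) ξ) (minJump (state J x ξ ρ) ρ) where
  measurableSet := h.measurableSet
  finite := h.finite
  measurable_ξ := h.measurable_minRate hJ
  measurable_ρ := by
    have hL := measurable_leftLim_predictable (h.measurable_state (x := x) hJ)
      fun t _ ω => h.tendsto_state_left ω
    have hM := measurable_runningMinLeft_predictable (h.measurable_state (x := x) hJ)
      h.tendsto_state_right
    have hρ := h.measurable_ρ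
    let _ : MeasurableSpace (ℝ≥0 × Ω) := 𝓖.predictable
    have hL' : Measurable fun p : (ℝ≥0 × Ω) × S =>
      Function.leftLim (fun s => state J x ξ ρ s p.1.2) p.1.1 := hL.comp measurable_fst
    have hM' : Measurable fun p : (ℝ≥0 × Ω) × S =>
      runningMinLeft (fun s => state J x ξ ρ s p.1.2) p.1.1 := hM.comp measurable_fst
    exact hM'.sub (hM'.min (measurable_const.max (hL'.sub hρ)))
  ξ_eq_zero t ω ht := by
    have := abs_minRate_le (state J x ξ ρ) ξ t ω
    rwa [h.ξ_eq_zero t ω ht, abs_zero, abs_nonpos_iff] at this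
  ρ_eq_zero t ω ht z := by
    have := abs_minJump_le ρ (h.runningMinLeft_le_leftLim (x := x) t ω) z
    rwa [h.ρ_eq_zero t ω ht, abs_zero, abs_nonpos_iff] at this
  integrable ω := by
    refine (h.integrable ω).mono ?_ (Eventually.of_forall fun t => abs_minRate_le _ ξ t ω)
    exact (((h.measurable_minRate hJ).mono predictable_le le_rfl).comp
      measurable_prodMk_right).aestronglyMeasurable

theorem state_minControl (h : IsLocalizedControl 𝓖 T J A ξ ρ) (hJ : IsCompatiblePoint J 𝓖 T P)
    (hx : 0 ≤ x) (t : ℝ≥0) (ω : Ω) :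
    state J x (minRate (state J x ξ ρ) ξ) (minJump (state J x ξ ρ) ρ) t ω =
      runningMin (fun s => state J x ξ ρ s ω) t := by
  obtain ⟨F, h0, hF⟩ := h.exists_jumpTimes (x := x) ω
  have h' := h.minControl (x := x) hJ
  have h1 := hF ξ ρ fun t => h.ρ_eq_zero t ω
  rw [congrFun (hF _ _ fun t => h'.ρ_eq_zero t ω) t]
  refine (runningMin_eq_jumpPath hx (h.integrable ω) h0 h1
    (Xm := Function.leftLim fun s => state J x ξ ρ s ω)
    (Mm := runningMinLeft fun s => state J x ξ ρ s ω)
    (fun t _ => tendsto_leftLim_of_tendsto (h.tendsto_state_left ω)) (fun _ _ => rfl)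
    (fun t _ => ?_) (fun t _ => ?_) (h'.integrable ω) t).symm
  · simp only [minRate]
  · cases J t ω with
    | none =>
      -- A listed time without a point has jump size zero; the update rule is consistent with this
      -- because `M_- ≤ X_-⁺`.
      simp only [Option.elim_none, sub_zero]
      rw [min_eq_left (h.runningMinLeft_le_leftLim t ω), sub_self]
    | some z => rfl

end IsLocalizedControl

end control

/-! ### Square-integrability and comparison of costs -/

theorem dt_Icc_lt_top (s t : ℝ≥0) : dt (Icc s t) < ∞ := by
  rw [← measure_congr (Ioc_ae_eq_Icc (μ := dt)), dt_Ioc]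
  exact ENNReal.ofReal_lt_top

theorem integrable_sq_of_lintegral {α : Type*} [MeasurableSpace α] {ν : Measure α} {f : α → ℝ}
    (hf : AEStronglyMeasurable f ν) (h : ∫⁻ a, ‖f a‖ₑ ^ 2 ∂ν < ∞) :
    Integrable (fun a => f a ^ 2) ν := by
  refine ⟨hf.pow 2, ?_⟩
  simpa only [HasFiniteIntegral, enorm_pow] using h

theorem integrable_of_integrable_sq {α : Type*} [MeasurableSpace α] {ν : Measure α}
    [IsFiniteMeasure ν] {f : α → ℝ} (hf : AEStronglyMeasurable f ν)
    (h : Integrable (fun a => f a ^ 2) ν) : Integrable f ν := by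
  refine ((integrable_const (1 : ℝ)).add h).mono' hf (Eventually.of_forall fun a => ?_)
  simp only [Real.norm_eq_abs, Pi.add_apply]
  nlinarith [sq_abs (f a), sq_nonneg (|f a| - 1), abs_nonneg (f a)]

/-- Cauchy–Schwarz against the constant `1`, read off from the nonnegativity of the integral of `(f
- c)²` with `c` the mean of `f`. -/
theorem sq_integral_le_measure_mul_integral_sq {α : Type*} [MeasurableSpace α] {ν : Measure α}
    [IsFiniteMeasure ν] {f : α → ℝ} (hf : Integrable f ν) (h : Integrable (fun a => f a ^ 2) ν) :
    (∫ a, f a ∂ν) ^ 2 ≤ ν.real univ * ∫ a, f a ^ 2 ∂ν := by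
  rcases (measureReal_nonneg (μ := ν) (s := univ)).eq_or_lt with h0 | hpos
  · have : ν = 0 := by
      rw [← Measure.measure_univ_eq_zero]
      exact (measureReal_eq_zero_iff (measure_ne_top _ _)).1 h0.symm
    simp [this]
  · set c := (∫ a, f a ∂ν) / ν.real univ with hc
    have h1 : 0 ≤ ∫ a, (f a - c) ^ 2 ∂ν := integral_nonneg fun a => sq_nonneg _
    have h2 : ∫ a, (f a - c) ^ 2 ∂ν =
        (∫ a, f a ^ 2 ∂ν) - 2 * c * (∫ a, f a ∂ν) + ν.real univ * c ^ 2 := by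
      have e : (fun a => (f a - c) ^ 2) = fun a => (f a ^ 2 - 2 * c * f a) + c ^ 2 := by
        ext a; ring
      have hc' : Integrable (fun a => 2 * c * f a) ν := hf.const_mul _
      have hs : Integrable (fun a => f a ^ 2 - 2 * c * f a) ν := h.sub hc'
      rw [e, integral_add hs (integrable_const _), integral_sub h hc', integral_const_mul,
        integral_const, smul_eq_mul]
    have h3 : ∫ a, f a ∂ν = c * ν.real univ := by rw [hc]; field_simp
    rw [h2, h3] at h1
    rw [h3]
    nlinarith

theorem measurable_restrict_measure {α : Type*} [MeasurableSpace α] {s : Set α}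
    (hs : MeasurableSet s) : Measurable fun ν : Measure α => ν.restrict s := by
  refine Measure.measurable_of_measurable_coe _ fun A hA => ?_
  simp only [Measure.restrict_apply hA]
  exact Measure.measurable_coe (hA.inter hs)

section state

variable {Ω S : Type*} [MeasurableSpace S] {T : ℝ≥0} {J : ℝ≥0 → Ω → Option S}
  {ξ : ℝ≥0 → Ω → ℝ} {ρ : ℝ≥0 → Ω → S → ℝ} {x : ℝ}

theorem state_congr {ξ' : ℝ≥0 → Ω → ℝ} {ρ' : ℝ≥0 → Ω → S → ℝ} {ω : Ω}
    (h : ∀ t ∈ Ioc 0 T, ξ' t ω = ξ t ω ∧ ∀ z, ρ' t ω z = ρ t ω z) {t : ℝ≥0} (ht : t ≤ T) :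
    state J x ξ' ρ' t ω = state J x ξ ρ t ω := by
  rw [state, state, setIntegral_congr_fun measurableSet_Ioc
    fun s hs => (h s ⟨hs.1, hs.2.trans ht⟩).1,
    setIntegral_congr_fun (measurableSet_Ioc.prod MeasurableSet.univ)
    fun q hq => (h q.1 ⟨hq.1.1, hq.1.2.trans ht⟩).2 q.2]

theorem state_neg (t : ℝ≥0) (ω : Ω) :
    state J (-x) (fun t ω => -ξ t ω) (fun t ω z => -ρ t ω z) t ω = -state J x ξ ρ t ω := by
  simp only [state, integral_neg]
  ring

theorem pathCost_le {μ : Measure S} {d m : ℕ} (c : Coefficients Ω S d m)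
    (Y : ℝ≥0 → Ω → EuclideanSpace ℝ (Fin d)) {ξ' : ℝ≥0 → Ω → ℝ} {ρ' : ℝ≥0 → Ω → S → ℝ} {ω : Ω}
    (hξ : ∀ t, |ξ' t ω| ≤ |ξ t ω|) (hρ : ∀ t z, |ρ' t ω z| ≤ |ρ t ω z|)
    (hs : ∀ t ≤ T, |state J x ξ' ρ' t ω| ≤ |state J x ξ ρ t ω|) :
    pathCost c T J μ Y x ξ' ρ' ω ≤ pathCost c T J μ Y x ξ ρ ω := by
  refine setLIntegral_mono' measurableSet_Icc fun s hs' => ?_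
  gcongr
  · exact enorm_le_iff_norm_le.2 (hξ s)
  · exact enorm_le_iff_norm_le.2 (hs s hs'.2)
  · exact enorm_le_iff_norm_le.2 (hρ s _)

end state

/-! ### Admissible controls: liquidation estimate and domination -/

section admissible

variable {Ω S : Type*} [mΩ : MeasurableSpace Ω] [MeasurableSpace S] {P : Measure Ω}
  {𝓖 : Filtration ℝ≥0 mΩ} {T : ℝ≥0} {J : ℝ≥0 → Ω → Option S} {μ : Measure S}
  {ξ : ℝ≥0 → Ω → ℝ} {ρ : ℝ≥0 → Ω → S → ℝ} {x : ℝ}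

theorem IsAdmissible.neg (h : IsAdmissible P 𝓖 T J μ x ξ ρ) :
    IsAdmissible P 𝓖 T J μ (-x) (fun t ω => -ξ t ω) fun t ω z => -ρ t ω z where
  measurable_ξ := h.measurable_ξ.neg
  measurable_ρ := h.measurable_ρ.neg
  integrable_ξ := by simpa only [enorm_neg] using h.integrable_ξ
  integrable_ρ := by simpa only [enorm_neg] using h.integrable_ρ
  terminal := by
    filter_upwards [h.terminal] with ω hω
    rw [state_neg, hω, neg_zero]

/-- Up to a null set, an admissible control agrees on `(0, T]` with a localized control. -/
theorem IsAdmissible.exists_localized [IsFiniteMeasure μ]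
    (h : IsAdmissible P 𝓖 T J μ x ξ ρ) (hP : ∀ N : Set Ω, P N = 0 → MeasurableSet[𝓖 0] N)
    (hJ : IsPoissonPointProcess J μ P) :
    ∃ A ξ' ρ', (∀ᵐ ω ∂P, ω ∈ A) ∧ IsLocalizedControl 𝓖 T J A ξ' ρ' ∧
      (∀ t ω, |ξ' t ω| ≤ |ξ t ω|) ∧ (∀ t ω z, |ρ' t ω z| ≤ |ρ t ω z|) ∧
      (∀ ω ∈ A, ∀ t ∈ Ioc 0 T, ξ' t ω = ξ t ω ∧ ∀ z, ρ' t ω z = ρ t ω z) ∧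
      ∀ ω ∈ A, IntegrableOn (fun t => ξ t ω ^ 2) (Icc 0 T) dt := by
  classical
  have hξ := h.measurable_ξ.mono predictable_le le_rfl
  have hξω : ∀ ω, Measurable fun t => ξ t ω := fun ω => hξ.comp measurable_prodMk_right
  let A : Set Ω := {ω | ∫⁻ s in Icc 0 T, ‖ξ s ω‖ₑ ^ 2 ∂dt < ∞ ∧
    jumpMeasure (fun r => J r ω) (Ioc 0 T ×ˢ univ) < ∞}
  have hA : ∀ᵐ ω ∂P, ω ∈ A := by
    have h1 : Measurable fun ω => ∫⁻ s in Icc 0 T, ‖ξ s ω‖ₑ ^ 2 ∂dt :=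
      ((hξ.enorm.pow_const 2).comp measurable_swap).lintegral_prod_right'
    filter_upwards [ae_lt_top h1 h.integrable_ξ.ne, hJ.ae_lt_top T] with ω h1 h2 using ⟨h1, h2⟩
  have hAm : MeasurableSet[𝓖 0] A := by
    -- Square integrability on `[0, T]` is not an event of the past at time `0`; only completeness
    -- puts `A` into `𝓖 0`.
    have := hP Aᶜ (by simpa [ae_iff, compl_def] using hA)
    simpa using this.compl
  have hR := measurableSet_predictable_prod_Ioc (𝓖 := 𝓖) hAm T
  have hfin : IsFiniteMeasure (dt.restrict (Icc 0 T)) := ⟨by simpa using dt_Icc_lt_top 0 T⟩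
  have hsq : ∀ ω ∈ A, IntegrableOn (fun t => ξ t ω ^ 2) (Icc 0 T) dt := fun ω hω =>
    integrable_sq_of_lintegral (hξω ω).aestronglyMeasurable hω.1
  refine ⟨A, fun t ω => if (t, ω) ∈ Ioc 0 T ×ˢ A then ξ t ω else 0,
    fun t ω z => if (t, ω) ∈ Ioc 0 T ×ˢ A then ρ t ω z else 0, hA, ⟨hAm, fun ω hω => hω.2, ?_, ?_,
    fun t ω ht => if_neg ht, fun t ω ht z => if_neg ht, fun ω => ?_⟩, fun t ω => ?_,
    fun t ω z => ?_, fun ω hω t ht => ⟨if_pos ⟨ht, hω⟩, fun z => if_pos ⟨ht, hω⟩⟩, hsq⟩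
  · have hm := h.measurable_ξ
    let _ : MeasurableSpace (ℝ≥0 × Ω) := 𝓖.predictable
    exact Measurable.ite hR hm measurable_const
  · have hm := h.measurable_ρ
    let _ : MeasurableSpace (ℝ≥0 × Ω) := 𝓖.predictable
    exact Measurable.ite (measurable_fst hR) hm measurable_const
  · by_cases hω : ω ∈ A
    · have h1 : IntegrableOn (fun t => ξ t ω) (Ioc 0 T) dt :=
        IntegrableOn.mono_set (integrable_of_integrable_sq
          (hξω ω).aestronglyMeasurable (hsq ω hω)) Ioc_subset_Icc_self
      refine (h1.integrable_indicator measurableSet_Ioc).congr (Eventually.of_forall fun t => ?_)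
      simp [indicator, hω]
    · simp [hω]
  · simp only; split_ifs <;> simp
  · simp only; split_ifs <;> simp

/-- In the absence of jumps in `(t, T]` the position at time `t` has to be liquidated at a rate,
and absence of jumps has positive conditional probability. -/
theorem IsAdmissible.sq_state_le [IsProbabilityMeasure P] [IsFiniteMeasure μ]
    (h : IsAdmissible P 𝓖 T J μ x ξ ρ) (hP : ∀ N : Set Ω, P N = 0 → MeasurableSet[𝓖 0] N)
    (hJ : IsPoissonPointProcess J μ P) (hcJ : IsCompatiblePoint J 𝓖 T P) {t : ℝ≥0} (ht : t ≤ T)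
    {K : ℝ} (hK : ∀ᵐ ω ∂P, |state J x ξ ρ t ω| ≤ K) :
    ∀ᵐ ω ∂P, |state J x ξ ρ t ω| ^ 2 ≤ Real.exp (T * μ.real univ) * ((T : ℝ) - t) *
      (P[fun ω' => ∫ s in Icc t T, (ξ s ω') ^ 2 ∂dt | 𝓖 t]) ω := by
  obtain ⟨A, ξ', ρ', hA, hloc, -, -, hcongr, hsq⟩ := h.exists_localized hP hJ
  set X := state J x ξ' ρ' t with hX
  have hXm : Measurable[𝓖 t] X := hloc.measurable_state hcJ t
  have hXeq : ∀ ω ∈ A, ∀ s ≤ T, state J x ξ' ρ' s ω = state J x ξ ρ s ω := fun ω hω s hs =>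
    state_congr (hcongr ω hω) hs
  set D : Set Ω := {ω | jumpMeasure (fun r => J r ω) (Ioc t T ×ˢ univ) = 0} with hD
  have htT : (0 : ℝ) ≤ T - t := sub_nonneg.2 (by exact_mod_cast ht)
  have hfinr : IsFiniteMeasure (dt.restrict (Ioc t T)) := ⟨by
    simpa using (measure_mono Ioc_subset_Icc_self).trans_lt (dt_Icc_lt_top t T)⟩
  have hIcc : ∀ f : ℝ≥0 → ℝ, ∫ s in Icc t T, f s ∂dt = ∫ s in Ioc t T, f s ∂dt := fun f =>
    setIntegral_congr_set Ioc_ae_eq_Icc.symm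
  -- the position on the event without jumps
  have hpath : ∀ᵐ ω ∂P, X ω ^ 2 * D.indicator 1 ω ≤
      ((T : ℝ) - t) * ∫ s in Icc t T, (ξ s ω) ^ 2 ∂dt := by
    filter_upwards [hA, h.terminal] with ω hω hterm
    by_cases hωD : ω ∈ D
    · have hsub : Ioc t T ⊆ Ioc 0 T := Ioc_subset_Ioc_left zero_le
      have hsqI : IntegrableOn (fun s => ξ s ω ^ 2) (Ioc t T) dt :=
        (hsq ω hω).mono_set (hsub.trans Ioc_subset_Icc_self)
      have e0 : ∀ s ∈ Ioc t T, ξ' s ω = ξ s ω := fun s hs => (hcongr ω hω s (hsub hs)).1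
      -- On `D` the counting measure does not charge `(t, T]`, so the terminal condition involves
      -- only jumps up to `t` and determines the position at `t`.
      have hjump : ∫ p in Ioc 0 T ×ˢ univ, ρ' p.1 ω p.2 ∂(jumpMeasure fun r => J r ω) =
          ∫ p in Ioc 0 t ×ˢ univ, ρ' p.1 ω p.2 ∂(jumpMeasure fun r => J r ω) := by
        refine setIntegral_congr_set ?_
        rw [← Ioc_union_Ioc_eq_Ioc (zero_le (a := t)) ht, union_prod]
        exact union_ae_eq_left_of_ae_eq_empty (ae_eq_empty.2 hωD)
      have hint : ∫ s in Ioc 0 T, ξ' s ω ∂dt =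
          (∫ s in Ioc 0 t, ξ' s ω ∂dt) + ∫ s in Ioc t T, ξ' s ω ∂dt := by
        rw [← Ioc_union_Ioc_eq_Ioc (zero_le (a := t)) ht, setIntegral_union
          (Ioc_disjoint_Ioc_of_le le_rfl) measurableSet_Ioc (hloc.integrable ω).integrableOn
          (hloc.integrable ω).integrableOn]
      have hval : X ω = ∫ s in Ioc t T, ξ s ω ∂dt := by
        have h1 := hXeq ω hω T le_rfl
        rw [hterm, state, hjump, hint] at h1
        rw [← setIntegral_congr_fun measurableSet_Ioc e0, hX, state]
        linarith
      have hi : IntegrableOn (fun s => ξ s ω) (Ioc t T) dt :=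
        (hloc.integrable ω).integrableOn.congr_fun e0 measurableSet_Ioc
      have hcs := sq_integral_le_measure_mul_integral_sq hi hsqI
      rw [measureReal_restrict_apply_univ, measureReal_def, dt_Ioc, ENNReal.toReal_ofReal htT] at hcs
      rw [indicator_of_mem hωD, Pi.one_apply, mul_one, hIcc, hval]
      exact hcs
    · rw [indicator_of_notMem hωD, mul_zero]
      exact mul_nonneg htT (integral_nonneg fun _ => sq_nonneg _)
  -- integrability
  have hXK : ∀ᵐ ω ∂P, |X ω| ≤ K := by
    filter_upwards [hK, hA] with ω h1 hω
    rwa [hX, hXeq ω hω t ht]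
  have hXsm : Measurable X := hXm.mono (𝓖.le t) le_rfl
  have hm1 : MeasurableSpace.comap (fun ω => (jumpMeasure fun r => J r ω).restrict
      (Ioc t T ×ˢ univ)) inferInstance ≤ mΩ :=
    ((measurable_restrict_measure (measurableSet_Ioc.prod MeasurableSet.univ)).comp
      hJ.measurable).comap_le
  have hD1 : MeasurableSet[MeasurableSpace.comap (fun ω => (jumpMeasure fun r => J r ω).restrict
      (Ioc t T ×ˢ univ)) inferInstance] D :=
    ⟨{ν | ν univ = 0}, (Measure.measurable_coe MeasurableSet.univ) (measurableSet_singleton 0), by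
      ext ω; simp [hD]⟩
  have hDm : MeasurableSet D := hm1 _ hD1
  have hDi : Integrable (D.indicator (1 : Ω → ℝ)) P :=
    (integrable_const (1 : ℝ)).indicator hDm
  -- The bound `K` serves only here: it provides the integrability needed to pull `X_t²` out of the
  -- conditional expectation. It does not enter the final constant.
  have hXDi : Integrable ((fun ω => X ω ^ 2) * D.indicator (1 : Ω → ℝ)) P := by
    refine hDi.bdd_mul (c := K ^ 2) (hXsm.pow_const 2).aestronglyMeasurable ?_
    filter_upwards [hXK] with ω hω
    rw [Real.norm_eq_abs, abs_pow]
    exact pow_le_pow_left₀ (abs_nonneg _) hω 2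
  have hξ := h.measurable_ξ.mono predictable_le le_rfl
  have hΞ : Integrable (fun ω => ∫ s in Icc t T, (ξ s ω) ^ 2 ∂dt) P := by
    have hfin : ∫⁻ q, ‖ξ q.2 q.1‖ₑ ^ 2 ∂(P.prod (dt.restrict (Icc t T))) < ∞ := by
      rw [lintegral_prod (fun q : Ω × ℝ≥0 => ‖ξ q.2 q.1‖ₑ ^ 2) ((hξ.enorm.pow_const 2).comp measurable_swap).aemeasurable]
      refine lt_of_le_of_lt (lintegral_mono fun ω => ?_) h.integrable_ξ
      exact lintegral_mono_set (Icc_subset_Icc_left zero_le)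
    exact (integrable_sq_of_lintegral (hξ.comp measurable_swap).aestronglyMeasurable
      hfin).integral_prod_left
  -- conditioning
  have hcond := condExp_mono (m := 𝓖 t) hXDi (hΞ.const_mul ((T : ℝ) - t)) hpath
  have hpull := condExp_mul_of_stronglyMeasurable_left (m := 𝓖 t)
    (f := fun ω => X ω ^ 2) (by
      let _ : MeasurableSpace Ω := 𝓖 t
      exact (hXm.pow_const 2).stronglyMeasurable) hXDi hDi
  have hind := condExp_indep_eq (f := D.indicator (1 : Ω → ℝ)) hm1 (𝓖.le t)
    (stronglyMeasurable_one.indicator hD1) (hcJ.indep t ht)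
  have hsmul := condExp_smul (μ := P) ((T : ℝ) - t)
    (fun ω => ∫ s in Icc t T, (ξ s ω) ^ 2 ∂dt) (𝓖 t)
  have hnn : 0 ≤ᵐ[P] P[fun ω' => ∫ s in Icc t T, (ξ s ω') ^ 2 ∂dt | 𝓖 t] :=
    condExp_nonneg (Eventually.of_forall fun ω => integral_nonneg fun _ => sq_nonneg _)
  have hPD : ∫ ω, D.indicator (1 : Ω → ℝ) ω ∂P = Real.exp (-((T - t) * μ.real univ)) := by
    rw [integral_indicator_one hDm, measureReal_def, hJ.measure_no_jump, dt_prod_Ioc,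
      ENNReal.toReal_ofReal (Real.exp_pos _).le, ENNReal.toReal_mul, ENNReal.toReal_ofReal htT]
    rfl
  filter_upwards [hcond, hpull, hind, hsmul, hnn, hA] with ω h1 h2 h3 h4 h5 hω
  have h6 : X ω ^ 2 * Real.exp (-((T - t) * μ.real univ)) ≤ ((T : ℝ) - t) *
      (P[fun ω' => ∫ s in Icc t T, (ξ s ω') ^ 2 ∂dt | 𝓖 t]) ω := by
    rw [h2, Pi.mul_apply, h3, hPD] at h1
    exact h1.trans_eq h4
  rw [← hXeq ω hω t ht, sq_abs, mul_assoc]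
  -- Replacing `T - t` by `T` in the exponent makes the constant independent of `t`.
  have h7 : Real.exp ((T - t) * μ.real univ) ≤ Real.exp (T * μ.real univ) :=
    Real.exp_le_exp.2 (mul_le_mul_of_nonneg_right (by simp) measureReal_nonneg)
  have h8 : X ω ^ 2 = Real.exp ((T - t) * μ.real univ) *
      (X ω ^ 2 * Real.exp (-((T - t) * μ.real univ))) := by
    rw [Real.exp_neg]; field_simp
  change X ω ^ 2 ≤ _
  rw [h8]
  exact mul_le_mul h7 h6 (by positivity) (Real.exp_pos _).le

/-- Every admissible control for a nonnegative initial position is dominated by an admissible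
control with nonincreasing nonnegative state. -/
theorem IsAdmissible.exists_antitone [MeasurableSingletonClass S] [IsFiniteMeasure μ]
    (h : IsAdmissible P 𝓖 T J μ x ξ ρ) (hP : ∀ N : Set Ω, P N = 0 → MeasurableSet[𝓖 0] N)
    (hJ : IsPoissonPointProcess J μ P) (hcJ : IsCompatiblePoint J 𝓖 T P) (hx : 0 ≤ x) :
    ∃ ξ' ρ', IsAdmissible P 𝓖 T J μ x ξ' ρ' ∧ (∀ t ω, |ξ' t ω| ≤ |ξ t ω|) ∧
      (∀ t ω z, |ρ' t ω z| ≤ |ρ t ω z|) ∧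
      (∀ᵐ ω ∂P, ∀ t ≤ T, |state J x ξ' ρ' t ω| ≤ |state J x ξ ρ t ω|) ∧
      (∀ ω, Antitone fun t => state J x ξ' ρ' t ω) ∧ ∀ t ω, |state J x ξ' ρ' t ω| ≤ |x| := by
  obtain ⟨A, ξ₀, ρ₀, hA, hloc, hξ₀, hρ₀, hcongr, -⟩ := h.exists_localized hP hJ
  have hstate : ∀ t ω, state J x (minRate (state J x ξ₀ ρ₀) ξ₀) (minJump (state J x ξ₀ ρ₀) ρ₀) t ω =
      runningMin (fun s => state J x ξ₀ ρ₀ s ω) t := hloc.state_minControl hcJ hx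
  have hloc' := hloc.minControl (x := x) hcJ
  have hξ : ∀ t ω, |minRate (state J x ξ₀ ρ₀) ξ₀ t ω| ≤ |ξ t ω| := fun t ω =>
    (abs_minRate_le _ _ t ω).trans (hξ₀ t ω)
  have hρ : ∀ t ω z, |minJump (state J x ξ₀ ρ₀) ρ₀ t ω z| ≤ |ρ t ω z| := fun t ω z =>
    (abs_minJump_le _ (hloc.runningMinLeft_le_leftLim t ω) z).trans (hρ₀ t ω z)
  have hle : ∀ ω ∈ A, ∀ t ≤ T, runningMin (fun s => state J x ξ₀ ρ₀ s ω) t ≤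
      max 0 (state J x ξ ρ t ω) := fun ω hω t ht => by
    rw [← state_congr (hcongr ω hω) ht]
    exact runningMin_le le_rfl
  refine ⟨_, _, ⟨hloc'.measurable_ξ, hloc'.measurable_ρ, ?_, ?_, ?_⟩, hξ, hρ, ?_, fun ω => ?_,
    fun t ω => ?_⟩
  · refine lt_of_le_of_lt (lintegral_mono fun ω => lintegral_mono fun s => ?_) h.integrable_ξ
    exact pow_le_pow_left' (enorm_le_iff_norm_le.2 (hξ s ω)) 2
  · refine lt_of_le_of_lt (lintegral_mono fun ω => lintegral_mono fun s =>
      lintegral_mono fun z => ?_) h.integrable_ρ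
    exact pow_le_pow_left' (enorm_le_iff_norm_le.2 (hρ s ω z)) 2
  · filter_upwards [hA, h.terminal] with ω hω hterm
    have := hle ω hω T le_rfl
    rw [hterm, max_self] at this
    rw [hstate]
    exact le_antisymm this (runningMin_nonneg _)
  · filter_upwards [hA] with ω hω t ht
    rw [hstate, abs_of_nonneg (runningMin_nonneg _)]
    exact (hle ω hω t ht).trans (max_le (abs_nonneg _) (le_abs_self _))
  · simp only [hstate]
    exact antitone_runningMin
  · rw [hstate, abs_of_nonneg (runningMin_nonneg _), abs_of_nonneg hx]
    have h0 : state J x ξ₀ ρ₀ 0 ω = x := by simp [state]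
    have := runningMin_le (X := fun s => state J x ξ₀ ρ₀ s ω) (zero_le (a := t))
    rwa [h0, max_eq_right hx] at this

/-- Every admissible control is dominated by an admissible control with monotone state. -/
theorem IsAdmissible.exists_monotone [MeasurableSingletonClass S] [IsFiniteMeasure μ]
    (h : IsAdmissible P 𝓖 T J μ x ξ ρ) (hP : ∀ N : Set Ω, P N = 0 → MeasurableSet[𝓖 0] N)
    (hJ : IsPoissonPointProcess J μ P) (hcJ : IsCompatiblePoint J 𝓖 T P) :
    ∃ ξ' ρ', IsAdmissible P 𝓖 T J μ x ξ' ρ' ∧ (∀ t ω, |ξ' t ω| ≤ |ξ t ω|) ∧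
      (∀ t ω z, |ρ' t ω z| ≤ |ρ t ω z|) ∧
      (∀ᵐ ω ∂P, ∀ t ≤ T, |state J x ξ' ρ' t ω| ≤ |state J x ξ ρ t ω|) ∧
      (∀ ω, (Monotone fun t => state J x ξ' ρ' t ω) ∨ Antitone fun t => state J x ξ' ρ' t ω) ∧
      ∀ t ω, |state J x ξ' ρ' t ω| ≤ |x| := by
  rcases le_total 0 x with hx | hx
  · obtain ⟨ξ', ρ', h1, h2, h3, h4, h5, h6⟩ := h.exists_antitone hP hJ hcJ hx
    exact ⟨ξ', ρ', h1, h2, h3, h4, fun ω => Or.inr (h5 ω), h6⟩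
  · obtain ⟨ξ', ρ', h1, h2, h3, h4, h5, h6⟩ :=
      h.neg.exists_antitone hP hJ hcJ (neg_nonneg.2 hx)
    have hst : ∀ t ω, state J x (fun t ω => -ξ' t ω) (fun t ω z => -ρ' t ω z) t ω =
        -state J (-x) ξ' ρ' t ω := fun t ω => by
      rw [← state_neg, neg_neg]
    refine ⟨fun t ω => -ξ' t ω, fun t ω z => -ρ' t ω z, ?_, fun t ω => ?_, fun t ω z => ?_, ?_,
      fun ω => Or.inl ?_, fun t ω => ?_⟩
    · simpa only [neg_neg] using h1.neg
    · simpa only [abs_neg] using h2 t ω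
    · simpa only [abs_neg] using h3 t ω z
    · filter_upwards [h4] with ω hω t ht
      have := hω t ht
      rwa [state_neg, abs_neg, ← abs_neg, ← hst] at this
    · simp only [hst]
      exact fun s t hst => neg_le_neg (h5 ω hst)
    · rw [hst, abs_neg, ← abs_neg x]
      exact h6 t ω

end admissible

end Liquidation

end

theorem lemma3p4 {Ω : Type*} [mΩ : MeasurableSpace Ω] (P : Measure Ω) [IsProbabilityMeasure P]
    (𝓖 : Filtration ℝ≥0 mΩ) (T : ℝ≥0) {d m l : ℕ}
    (Z : Set (EuclideanSpace ℝ (Fin l))) (hZ : MeasurableSet Z) (hZne : Z.Nonempty)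
    (μ : Measure Z) [IsFiniteMeasure μ]
    (W B : ℝ≥0 → Ω → Fin m → ℝ) (J : ℝ≥0 → Ω → Option Z)
    (hnoise : Liquidation.IsNoise P 𝓖 T W B J μ)
    (c : Liquidation.Coefficients Ω Z d m)
    (hc : c.IsRegular P hnoise.filtrationW T) :
    ∃ C : ℝ, ∀ (x : ℝ) (ξ : ℝ≥0 → Ω → ℝ) (ρ : ℝ≥0 → Ω → Z → ℝ),
      Liquidation.IsAdmissible P 𝓖 T J μ x ξ ρ →
      ∃ (ξ' : ℝ≥0 → Ω → ℝ) (ρ' : ℝ≥0 → Ω → Z → ℝ),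
        Liquidation.IsAdmissible P 𝓖 T J μ x ξ' ρ' ∧
        (∀ (y : EuclideanSpace ℝ (Fin d)) (Y : ℝ≥0 → Ω → EuclideanSpace ℝ (Fin d)),
          Liquidation.IsFactorProcess c P 𝓖 T W B y Y →
          Liquidation.cost c P 𝓖 T J μ Y x ξ' ρ' ≤ᵐ[P]
            Liquidation.cost c P 𝓖 T J μ Y x ξ ρ) ∧
        (∀ᵐ ω ∂P, MonotoneOn (fun t => Liquidation.state J x ξ' ρ' t ω) (Icc 0 T) ∨
          AntitoneOn (fun t => Liquidation.state J x ξ' ρ' t ω) (Icc 0 T)) ∧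
        ∀ t ≤ T, ∀ᵐ ω ∂P, |Liquidation.state J x ξ' ρ' t ω| ^ 2 ≤
          C * ((T : ℝ) - t) * (P[fun ω' => ∫ s in Icc t T, (ξ' s ω') ^ 2 ∂Liquidation.dt | 𝓖 t]) ω := by
  -- The constant is the reciprocal of the probability of no jump in `(0, T]`.
  refine ⟨Real.exp (T * μ.real univ), fun x ξ ρ h => ?_⟩
  obtain ⟨ξ', ρ', h1, h2, h3, h4, h5, h6⟩ :=
    h.exists_monotone hnoise.complete hnoise.poisson hnoise.compatible_J
  refine ⟨ξ', ρ', h1, fun y Y _ => ?_, Eventually.of_forall fun ω => ?_, fun t ht => ?_⟩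
  · refine condLExp_mono ?_
    filter_upwards [h4] with ω hω
    exact Liquidation.pathCost_le c Y (fun t => h2 t ω) (fun t z => h3 t ω z) hω
  · exact (h5 ω).imp (fun h => h.monotoneOn _) fun h => h.antitoneOn _
  -- The monotone state stays between `0` and `x`, which supplies the bound `K = |x|`.
  · exact h1.sq_state_le hnoise.complete hnoise.poisson hnoise.compatible_J ht
      (Eventually.of_forall (h6 t))
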